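/- Let $M$ be a connected smooth manifold of dimension $n\ge 2$ and $F:TM\to[0,\infty)$ a Finsler norm: $F$ is smooth on the slit tangent bundle $\widetilde{TM}=TM\setminus\{0\}$, $F(cu)=cF(u)$ for $c>0$, and for every $u\in T_xM\setminus\{0\}$ the fundamental tensor $g_u(v,w)=\tfrac12\frac{\partial^2}{\partial t\,\partial s}\big|_{t=s=0}F^2(u+tv+sw)$ is positive definite on $T_xM$. For $X\in T_xM$ and $u\in T_xM\setminus\{0\}$ let $X^v=\frac{d}{dt}\big|_{0}(u+tX)$ be the vertical lift and $X^h=X^i\frac{\partial}{\partial x^i}-\Gamma^i_{jk}X^ju^k\frac{\partial}{\partial u^i}$ the horizontal lift at $u$ with respect to the Chern connection. Put $r^2=F(u)^2$. Let $G$ be a pseudo-Riemannian metric (smooth, symmetric, nondegenerate) on $\widetilde{TM}$ which is $F$-natural, i.e. there are functions $\alpha_i,\beta_i:(0,\infty)\to\mathbb R$, $i=1,2,3$, such that at every $u\in T_xM\setminus\{0\}$ and for all $X,Y\in T_xM$ $$\begin{aligned}G(X^h,Y^h)&=(\alpha_1+\alpha_3)(r^2)\,g_u(X,Y)+(\beta_1+\beta_3)(r^2)\,g_u(X,u)g_u(Y,u),\\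 G(X^h,Y^v)&=\alpha_2(r^2)\,g_u(X,Y)+\beta_2(r^2)\,g_u(X,u)g_u(Y,u),\\ G(X^v,Y^v)&=\alpha_1(r^2)\,g_u(X,Y)+\beta_1(r^2)\,g_u(X,u)g_u(Y,u).\end{aligned}$$ (The Kaluza–Klein type metrics are those with $\alpha_2=\beta_2=0$.) Let $\mathcal V$ be the Liouville vector field, $\mathcal V(u)=u^v$. A vector field $V$ on $\widetilde{TM}$ is conformal with potential function $\theta\in C^\infty(\widetilde{TM})$ if $\mathcal L_VG=2\theta G$; it is homothetic if $\theta$ is constant and Killing if $\theta=0$. Call real constants $a_1,a_2,a_3,b_1,b_2,b_3$ regular if $a_1a_3-a_2^2\ne0$ and $(a_1+b_1)(a_3+b_3)-(a_2+b_2)^2\neq0$. 1. $\mathcal V$ is conformal on $(\widetilde{TM},G)$ if and only if there are a nowhere zero function $\lambda:(0,\infty)\to\mathbb R$ and regular constants $a_i,b_i$ such that, for all $t>0$, $$\alpha_1=a_1\lambda,\quad \alpha_2=a_2\sqrt t\,\lambda,\quad \alpha_1+\alpha_3=a_3t\lambda,\quad \beta_1=b_1\frac{\lambda}{t},\quad \beta_2=b_2\frac{\lambda}{\sqrt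 t},\quad \beta_1+\beta_3=b_3\lambda.$$ Furthermore, for any such $\lambda,a_i,b_i$, the function $\lambda$ is smooth, and $\theta$ is a potential function of $\mathcal V$ if and only if $\theta(u)=1+\dfrac{r^2\lambda'(r^2)}{\lambda(r^2)}$ for all $u\in\widetilde{TM}$. 2. For every $\theta_0\in\mathbb R$, $\mathcal V$ is homothetic on $(\widetilde{TM},G)$ with constant potential $\theta_0$ if and only if there are regular constants $a_i,b_i$ such that, for all $t>0$, $$\alpha_1=a_1t^{\theta_0-1},\quad \alpha_2=a_2t^{\theta_0-\frac12},\quad \alpha_1+\alpha_3=a_3t^{\theta_0},\quad \beta_1=b_1t^{\theta_0-2},\quad \beta_2=b_2t^{\theta_0-\frac32},\quad \beta_1+\beta_3=b_3t^{\theta_0-1}.$$ 3. $\mathcal V$ is a Killing vector field on $(\widetilde{TM},G)$ if and only if there are regular constants $a_i,b_i$ such that, for all $t>0$, $$\alpha_1=a_1t^{-1},\quad \alpha_2=a_2t^{-\frac12},\quad \alpha_1+\alpha_3=a_3,\quad \beta_1=b_1t^{-2},\quad \beta_2=b_2t^{-\frac32},\quad \beta_1+\beta_3=b_3t^{-1}.$$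 -/

import Mathlib

open Set Bundle
open scoped Manifold ContDiff Topology

noncomputable section

namespace FinslerLiouville

/-- The model space `ℝⁿ`, in which the coordinates of an `n`-manifold take their values. -/
abbrev Euc (n : ℕ) : Type := EuclideanSpace ℝ (Fin n)

/-- The tangent bundle `TM` of an `n`-manifold `M`; a point of it is `p = ⟨x, u⟩` with
`u ∈ T_x M`. -/
abbrev TM (n : ℕ) (M : Type*) [TopologicalSpace M] [ChartedSpace (Euc n) M] :=
  TangentBundle (𝓡 n) M

/-- The slit tangent bundle, an open subset of `TM`. -/
def slit (n : ℕ) (M : Type*) [TopologicalSpace M] [ChartedSpace (Euc n) M] : Set (TM n M) :=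
  {p | p.2 ≠ 0}

section LocalCoordinates

/-! ### The Chern connection in induced coordinates

Below `L : ℝⁿ × ℝⁿ → ℝ` stands for the coordinate expression of `F ^ 2` in induced coordinates
`(x¹, …, xⁿ, u¹, …, uⁿ)` of `TM`. -/

variable {n : ℕ}

/-- The partial derivative `∂f / ∂xⁱ`. -/
def dx (i : Fin n) (f : Euc n × Euc n → ℝ) (z : Euc n × Euc n) : ℝ :=
  fderiv ℝ f z (EuclideanSpace.single i 1, 0)

/-- The partial derivative `∂f / ∂uⁱ`. -/
def du (i : Fin n) (f : Euc n × Euc n → ℝ) (z : Euc n × Euc n) : ℝ :=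
  fderiv ℝ f z (0, EuclideanSpace.single i 1)

/-- `g_{ij} = (1/2) ∂²F² / ∂uⁱ∂uʲ`. -/
def gLow (L : Euc n × Euc n → ℝ) (i j : Fin n) (z : Euc n × Euc n) : ℝ :=
  (1 / 2) * du i (du j L) z

/-- The entries `g^{ij}` of the inverse of the matrix `(g_{ij})`. -/
def gUp (L : Euc n × Euc n → ℝ) (i j : Fin n) (z : Euc n × Euc n) : ℝ :=
  (Matrix.of fun k l => gLow L k l z)⁻¹ i j

/-- The Cartan tensor `C_{ijk} = (1/4) ∂³F² / ∂uⁱ∂uʲ∂uᵏ`. -/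
def cartanLow (L : Euc n × Euc n → ℝ) (i j k : Fin n) (z : Euc n × Euc n) : ℝ :=
  (1 / 4) * du i (du j (du k L)) z

/-- The Cartan tensor with one index raised, `C^i_{jk} = ∑ₗ g^{il} C_{ljk}`. -/
def cartanUp (L : Euc n × Euc n → ℝ) (i j k : Fin n) (z : Euc n × Euc n) : ℝ :=
  ∑ l, gUp L i l z * cartanLow L l j k z

/-- The formal Christoffel symbols
`γ^i_{jk} = (1/2) ∑ₗ g^{il} (∂g_{lj}/∂xᵏ + ∂g_{lk}/∂xʲ - ∂g_{jk}/∂xˡ)`. -/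
def formalChristoffel (L : Euc n × Euc n → ℝ) (i j k : Fin n) (z : Euc n × Euc n) : ℝ :=
  (1 / 2) * ∑ l, gUp L i l z *
    (dx k (gLow L l j) z + dx j (gLow L l k) z - dx l (gLow L j k) z)

/-- The coefficients of the canonical nonlinear connection,
`N^i_j = ∑ₖ γ^i_{jk} uᵏ - ∑_{k,r,s} C^i_{jk} γ^k_{rs} uʳ uˢ`. -/
def nonlinearCoeff (L : Euc n × Euc n → ℝ) (i j : Fin n) (z : Euc n × Euc n) : ℝ :=
  ∑ k, formalChristoffel L i j k z * z.2 k
    - ∑ k, ∑ r, ∑ s, cartanUp L i j k z * formalChristoffel L k r s z * z.2 r * z.2 s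

/-- The horizontal derivative `δf/δxⁱ = ∂f/∂xⁱ - ∑ⱼ N^j_i ∂f/∂uʲ`. -/
def deltax (L : Euc n × Euc n → ℝ) (i : Fin n) (f : Euc n × Euc n → ℝ)
    (z : Euc n × Euc n) : ℝ :=
  dx i f z - ∑ j, nonlinearCoeff L j i z * du j f z

/-- The Christoffel symbols of the Chern connection,
`Γ^i_{jk} = (1/2) ∑ₗ g^{il} (δg_{lj}/δxᵏ + δg_{lk}/δxʲ - δg_{jk}/δxˡ)`. -/
def chernChristoffel (L : Euc n × Euc n → ℝ) (i j k : Fin n) (z : Euc n × Euc n) : ℝ :=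
  (1 / 2) * ∑ l, gUp L i l z *
    (deltax L k (gLow L l j) z + deltax L j (gLow L l k) z - deltax L l (gLow L j k) z)

end LocalCoordinates

section Manifold

variable {n : ℕ} {M : Type*} [TopologicalSpace M] [ChartedSpace (Euc n) M]
  [IsManifold (𝓡 n) ∞ M]

/-- The form `g_u(v, w) = (1/2) ∂²F²(u + t v + s w) / ∂t∂s` at `t = s = 0`, where `p = ⟨x, u⟩`. -/
def fundamentalTensor (F : TM n M → ℝ) (p : TM n M) (v w : TangentSpace (𝓡 n) p.1) : ℝ :=
  (1 / 2) * deriv (fun t : ℝ => deriv (fun s : ℝ =>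
    F (⟨p.1, p.2 + t • v + s • w⟩ : TM n M) ^ 2) 0) 0

/-- `F` is a Finsler norm on `M`. -/
structure IsFinslerNorm (F : TM n M → ℝ) : Prop where
  nonneg : ∀ p, 0 ≤ F p
  smooth : ContMDiffOn (𝓡 n).tangent 𝓘(ℝ, ℝ) ∞ F (slit n M)
  homogeneous : ∀ (p : TM n M) (c : ℝ), 0 < c → F (⟨p.1, c • p.2⟩ : TM n M) = c * F p
  posDef : ∀ p ∈ slit n M, ∀ v : TangentSpace (𝓡 n) p.1, v ≠ 0 → 0 < fundamentalTensor F p v v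

/-- The expression of `F ^ 2` in the coordinates of `TM` induced by the preferred chart of `M` at
the base point of `p`. -/
def localSq (F : TM n M → ℝ) (p : TM n M) (z : Euc n × Euc n) : ℝ :=
  F ((extChartAt (𝓡 n).tangent p).symm z) ^ 2

/-- The horizontal lift `X^h = ∑ᵢ Xⁱ ∂/∂xⁱ - ∑_{i,j,k} Γ^i_{jk} Xʲ uᵏ ∂/∂uⁱ` at `p = ⟨x, u⟩` of
`X ∈ T_x M`, with respect to the Chern connection. In Mathlib the tangent space of a manifold at a
point *is* the model vector space, by means of the preferred chart at that point; so `X` is the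
tuple of its components, and a pair in `ℝⁿ × ℝⁿ` is a tangent vector of `TM` at `p` written in the
frame `∂/∂xⁱ, ∂/∂uⁱ` of the induced coordinates. -/
def horizontalLift (F : TM n M → ℝ) (p : TM n M) (X : TangentSpace (𝓡 n) p.1) :
    TangentSpace (𝓡 n).tangent p :=
  let z : Euc n × Euc n := extChartAt (𝓡 n).tangent p p
  let X' : Euc n := X
  let Y : Euc n := WithLp.toLp 2 fun i =>
    -∑ j, ∑ k, chernChristoffel (localSq F p) i j k z * X' j * z.2 k
  ((X', Y) : Euc n × Euc n)

/-- The vertical lift at `p = ⟨x, u⟩` of `X ∈ T_x M`: the velocity at `t = 0` of the curve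
`t ↦ u + t X`. -/
def verticalLift (p : TM n M) (X : TangentSpace (𝓡 n) p.1) : TangentSpace (𝓡 n).tangent p :=
  mfderiv 𝓘(ℝ, ℝ) (𝓡 n).tangent (fun t : ℝ => (⟨p.1, p.2 + t • X⟩ : TM n M)) 0 (1 : ℝ)

/-- The Liouville vector field, `𝒱(u) = ` the vertical lift of `u` at `u`. -/
def liouville (p : TM n M) : TangentSpace (𝓡 n).tangent p := verticalLift p p.2

/-- `Y` is a smooth vector field on the subset `U` of `TM`. -/
def IsSmoothField (Y : ∀ p : TM n M, TangentSpace (𝓡 n).tangent p) (U : Set (TM n M)) : Prop :=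
  ContMDiffOn (𝓡 n).tangent (𝓡 n).tangent.tangent ∞
    (fun p => (⟨p, Y p⟩ : TangentBundle (𝓡 n).tangent (TM n M))) U

/-- `G` is a pseudo-Riemannian metric on the slit tangent bundle: a smooth field of nondegenerate
symmetric bilinear forms. (The values of `G` on the zero section play no role.) -/
structure IsPseudoRiemannian (G : ∀ p : TM n M, TangentSpace (𝓡 n).tangent p →L[ℝ]
    TangentSpace (𝓡 n).tangent p →L[ℝ] ℝ) : Prop where
  smooth : ContMDiffOn (𝓡 n).tangent
    ((𝓡 n).tangent.prod 𝓘(ℝ, (Euc n × Euc n) →L[ℝ] (Euc n × Euc n) →L[ℝ] ℝ)) ∞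
    (fun p => TotalSpace.mk' ((Euc n × Euc n) →L[ℝ] (Euc n × Euc n) →L[ℝ] ℝ)
      (E := fun p : TM n M => TangentSpace (𝓡 n).tangent p →L[ℝ]
        TangentSpace (𝓡 n).tangent p →L[ℝ] ℝ) p (G p)) (slit n M)
  symm : ∀ p ∈ slit n M, ∀ v w, G p v w = G p w v
  nondegenerate : ∀ p ∈ slit n M, ∀ v, (∀ w, G p v w = 0) → v = 0

/-- `G` is the `F`-natural metric on the slit tangent bundle with defining functions `αᵢ, βᵢ`
(only their values on `]0, ∞[` matter). Here `g(X, 𝒰) = g_u(X, u)` and `r² = F(u)²`. -/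
structure IsFNatural (F : TM n M → ℝ) (α₁ α₂ α₃ β₁ β₂ β₃ : ℝ → ℝ)
    (G : ∀ p : TM n M, TangentSpace (𝓡 n).tangent p →L[ℝ]
      TangentSpace (𝓡 n).tangent p →L[ℝ] ℝ) : Prop where
  hh : ∀ p ∈ slit n M, ∀ X Y : TangentSpace (𝓡 n) p.1,
    G p (horizontalLift F p X) (horizontalLift F p Y) =
      (α₁ (F p ^ 2) + α₃ (F p ^ 2)) * fundamentalTensor F p X Y
      + (β₁ (F p ^ 2) + β₃ (F p ^ 2)) *
        (fundamentalTensor F p X p.2 * fundamentalTensor F p Y p.2)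
  hv : ∀ p ∈ slit n M, ∀ X Y : TangentSpace (𝓡 n) p.1,
    G p (horizontalLift F p X) (verticalLift p Y) =
      α₂ (F p ^ 2) * fundamentalTensor F p X Y
      + β₂ (F p ^ 2) * (fundamentalTensor F p X p.2 * fundamentalTensor F p Y p.2)
  vv : ∀ p ∈ slit n M, ∀ X Y : TangentSpace (𝓡 n) p.1,
    G p (verticalLift p X) (verticalLift p Y) =
      α₁ (F p ^ 2) * fundamentalTensor F p X Y
      + β₁ (F p ^ 2) * (fundamentalTensor F p X p.2 * fundamentalTensor F p Y p.2)

/-- The Lie derivative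
`(ℒ_V G)(Y, Z) = V(G(Y, Z)) - G([V, Y], Z) - G(Y, [V, Z])`, evaluated at `p`. -/
def lieDerivative (V : ∀ p : TM n M, TangentSpace (𝓡 n).tangent p)
    (G : ∀ p : TM n M, TangentSpace (𝓡 n).tangent p →L[ℝ]
      TangentSpace (𝓡 n).tangent p →L[ℝ] ℝ)
    (Y Z : ∀ p : TM n M, TangentSpace (𝓡 n).tangent p) (p : TM n M) : ℝ :=
  let D : ℝ := mfderiv (𝓡 n).tangent 𝓘(ℝ, ℝ) (fun q => G q (Y q) (Z q)) p (V p)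
  D - G p (VectorField.mlieBracket (𝓡 n).tangent V Y p) (Z p)
    - G p (Y p) (VectorField.mlieBracket (𝓡 n).tangent V Z p)

/-- `V` is a conformal vector field on the slit tangent bundle with metric `G` and potential
function `θ`: `θ` is smooth and `ℒ_V G = 2 θ G`. Both sides are tensors, so they are compared on
all local vector fields. -/
def IsConformalWith (V : ∀ p : TM n M, TangentSpace (𝓡 n).tangent p)
    (G : ∀ p : TM n M, TangentSpace (𝓡 n).tangent p →L[ℝ]
      TangentSpace (𝓡 n).tangent p →L[ℝ] ℝ) (θ : TM n M → ℝ) : Prop :=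
  ContMDiffOn (𝓡 n).tangent 𝓘(ℝ, ℝ) ∞ θ (slit n M) ∧
  ∀ U : Set (TM n M), IsOpen U → U ⊆ slit n M →
    ∀ Y Z : ∀ p : TM n M, TangentSpace (𝓡 n).tangent p,
      IsSmoothField Y U → IsSmoothField Z U →
      ∀ p ∈ U, lieDerivative V G Y Z p = 2 * θ p * G p (Y p) (Z p)

/-- `V` is a conformal vector field. -/
def IsConformal (V : ∀ p : TM n M, TangentSpace (𝓡 n).tangent p)
    (G : ∀ p : TM n M, TangentSpace (𝓡 n).tangent p →L[ℝ]
      TangentSpace (𝓡 n).tangent p →L[ℝ] ℝ) : Prop :=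
  ∃ θ : TM n M → ℝ, IsConformalWith V G θ

/-- `V` is a homothetic vector field with constant potential `θ₀`. -/
def IsHomotheticWith (V : ∀ p : TM n M, TangentSpace (𝓡 n).tangent p)
    (G : ∀ p : TM n M, TangentSpace (𝓡 n).tangent p →L[ℝ]
      TangentSpace (𝓡 n).tangent p →L[ℝ] ℝ) (θ₀ : ℝ) : Prop :=
  IsConformalWith V G fun _ => θ₀

/-- `V` is a Killing vector field. -/
def IsKilling (V : ∀ p : TM n M, TangentSpace (𝓡 n).tangent p)
    (G : ∀ p : TM n M, TangentSpace (𝓡 n).tangent p →L[ℝ]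
      TangentSpace (𝓡 n).tangent p →L[ℝ] ℝ) : Prop :=
  IsConformalWith V G fun _ => 0

end Manifold

/-- `a₁a₃ - a₂² ≠ 0` and `(a₁+b₁)(a₃+b₃) - (a₂+b₂)² ≠ 0`. -/
def Regular (a₁ a₂ a₃ b₁ b₂ b₃ : ℝ) : Prop :=
  a₁ * a₃ - a₂ ^ 2 ≠ 0 ∧ (a₁ + b₁) * (a₃ + b₃) - (a₂ + b₂) ^ 2 ≠ 0

/-- On `]0, ∞[` the function `lam` has no zero, and `α₁ = a₁ lam`, `α₂ = a₂ √t lam`,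
`α₁ + α₃ = a₃ t lam`, `β₁ = b₁ lam / t`, `β₂ = b₂ lam / √t`, `β₁ + β₃ = b₃ lam`. -/
def HasForm (α₁ α₂ α₃ β₁ β₂ β₃ lam : ℝ → ℝ) (a₁ a₂ a₃ b₁ b₂ b₃ : ℝ) : Prop :=
  ∀ t : ℝ, 0 < t → lam t ≠ 0 ∧
    α₁ t = a₁ * lam t ∧ α₂ t = a₂ * √t * lam t ∧ α₁ t + α₃ t = a₃ * t * lam t ∧
    β₁ t = b₁ * (lam t / t) ∧ β₂ t = b₂ * (lam t / √t) ∧ β₁ t + β₃ t = b₃ * lam t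

end FinslerLiouville

end

/-! The flow of `liouville` consists of fibrewise scalings, so the Lie derivative of `G` along it is
the derivative at `s = 1` of the pull-back of `G` by `u ↦ s u` (`hasDerivAt_lieDerivative`,
`isConformalWith_liouville_iff`).

This pull-back is explicit. The fundamental tensor and the Chern symbols are homogeneous of degree 0
in `u`, so scaling carries horizontal lifts to horizontal lifts (`hLift_scale`) and multiplies
vertical lifts by `s`. Hence the pulled-back metric has the same shape as `G`, each coefficient
`f(t)`, `t = r²`, being replaced by `s^k f(s² t)`, with `k = 0, 1, 2` for `α₁ + α₃, α₂, α₁` and `k =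
2, 3, 4` for `β₁ + β₃, β₂, β₁` (`metricAlong_scale`).

Testing on a vector `g_u`-orthogonal to `u`, which exists since `n ≥ 2`, and then on `u` itself
separates the six coefficients. Conformality thus gives six linear equations `t f' = (Θ - k/2) f`
with one common `Θ` (`scalesAt_of_hasDerivAt`). They are solved without integrating `Θ`: the
determinant `D = (α₁ + α₃) α₁ - α₂²` satisfies `t D' = (2Θ - 1) D` and has no zero because `G` is
nondegenerate, so `λ = √|D/t|` solves `t λ' = (Θ - 1) λ`, and each quotient `f / (t^(1 - k/2) λ)` is
constant (`exists_hasForm_of_ode`). Nondegeneracy also makes the constants regular.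

Conversely, for coefficients of this form the pull-back is `s² λ(s² t) / λ(t)` times `G`, whose
derivative at `s = 1` gives the potential (`hasDerivAt_scalePull_of_hasForm`). If the potential is a
constant `θ₀`, the equation for `λ` forces `λ = c t^(θ₀ - 1)`; the Killing case is `θ₀ = 0`. -/

noncomputable section

namespace FinslerLiouville

/-! ### Fibres, scalings and the Liouville field in the charts of `TM` -/

section TangentCalculus

variable {n : ℕ} {M : Type*} [TopologicalSpace M] [ChartedSpace (Euc n) M]
  [IsManifold (𝓡 n) ∞ M]

/-- The tangent vector at `x` with components `u` in the preferred chart at `x`. -/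
def tvec (x : M) (u : Euc n) : TM n M := ⟨x, u⟩

/-- The preferred chart of `TM` at a point depends only on the base point, so one chart serves a
whole fibre, and there the coordinate change is the identity. -/
lemma extChartAt_tvec (x : M) (v u : Euc n) :
    extChartAt (𝓡 n).tangent (tvec x v) (tvec x u) = (extChartAt (𝓡 n) x x, u) := by
  rw [FiberBundle.extChartAt]
  simp only [PartialEquiv.coe_trans, Function.comp]
  refine Prod.ext rfl ?_
  exact (tangentBundleCore (𝓡 n) M).coordChange_self (achart _ x) x (mem_achart_source _ x) u

lemma contMDiff_tvec (x : M) :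
    ContMDiff 𝓘(ℝ, Euc n) (𝓡 n).tangent ∞ (tvec x : Euc n → TM n M) := by
  intro u
  refine contMDiffAt_totalSpace.2 ⟨contMDiffAt_const, ?_⟩
  have : (fun v : Euc n => (trivializationAt (Euc n) (TangentSpace (𝓡 n)) x
      (tvec x v : TM n M)).2) = id := by
    funext v
    exact (tangentBundleCore (𝓡 n) M).coordChange_self (achart _ x) x (mem_achart_source _ x) v
  exact this ▸ contMDiffAt_id

lemma hasMFDerivAt_tvec_curve (x : M) {c : ℝ → Euc n} {c' : Euc n} {t : ℝ}
    (hc : HasDerivAt c c' t) :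
    HasMFDerivAt 𝓘(ℝ, ℝ) (𝓡 n).tangent (fun s : ℝ => (tvec x (c s) : TM n M)) t
      (ContinuousLinearMap.toSpanSingleton ℝ ((0, c') : Euc n × Euc n)) := by
  have h1 : MDifferentiableAt 𝓘(ℝ, ℝ) (𝓡 n).tangent (fun s : ℝ => (tvec x (c s) : TM n M)) t :=
    ((contMDiff_tvec x).mdifferentiableAt (by simp)).comp t
      hc.differentiableAt.mdifferentiableAt
  refine ⟨h1.continuousAt, ?_⟩
  have : writtenInExtChartAt 𝓘(ℝ, ℝ) (𝓡 n).tangent t (fun s : ℝ => (tvec x (c s) : TM n M)) =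
      fun s => (extChartAt (𝓡 n) x x, c s) := by
    funext s
    exact extChartAt_tvec x (c t) (c s)
  rw [this]
  simp only [modelWithCornersSelf_coe, range_id]
  exact ((hasDerivAt_const t (extChartAt (𝓡 n) x x)).prodMk hc).hasFDerivAt.hasFDerivWithinAt

/-- The components of a tangent vector in the preferred chart at its base point. -/
def fib (p : TM n M) : Euc n := p.2

lemma verticalLift_eq (p : TM n M) (X : Euc n) :
    verticalLift p X = ((0, X) : Euc n × Euc n) := by
  have h2 : HasDerivAt (fun t : ℝ => fib p + t • X) ((1:ℝ) • X) 0 :=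
    ((hasDerivAt_id (0:ℝ)).smul_const X).const_add _
  rw [one_smul] at h2
  have h := congrArg (fun f => f (1 : ℝ)) (hasMFDerivAt_tvec_curve p.1 h2).mfderiv
  exact h.trans (one_smul ℝ ((0, X) : Euc n × Euc n))

lemma liouville_eq (p : TM n M) : liouville p = ((0, fib p) : Euc n × Euc n) :=
  verticalLift_eq p (fib p)

/-- The fibrewise scaling `u ↦ s u`. -/
def scale (s : ℝ) (p : TM n M) : TM n M := tvec p.1 (s • fib p)

lemma hasMFDerivAt_scale (p : TM n M) (s : ℝ) :
    HasMFDerivAt 𝓘(ℝ, ℝ) (𝓡 n).tangent (fun s : ℝ => scale s p) s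
      (ContinuousLinearMap.toSpanSingleton ℝ ((0, fib p) : Euc n × Euc n)) := by
  refine hasMFDerivAt_tvec_curve p.1 ?_
  simpa using (hasDerivAt_id s).smul_const (fib p)

lemma contMDiff_scale (p : TM n M) :
    ContMDiff 𝓘(ℝ, ℝ) (𝓡 n).tangent ∞ (fun s : ℝ => scale s p) :=
  (contMDiff_tvec p.1).comp (contDiff_id.smul contDiff_const).contMDiff

omit [IsManifold (𝓡 n) ∞ M] in
lemma scale_one (p : TM n M) : scale 1 p = p := by
  simp only [scale, one_smul]
  rfl

lemma extChartAt_tangent_snd (p q : TM n M) :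
    (extChartAt (𝓡 n).tangent p q).2 = tangentCoordChange (𝓡 n) q.1 p.1 q.1 (fib q) := by
  rw [FiberBundle.extChartAt]
  rfl

/-- Coordinate changes of `TM` are linear on fibres, so they commute with scaling. -/
lemma extChartAt_tangent_scale (p q : TM n M) (s : ℝ) :
    extChartAt (𝓡 n).tangent p (scale s q) =
      ((extChartAt (𝓡 n).tangent p q).1, s • (extChartAt (𝓡 n).tangent p q).2) := by
  refine Prod.ext ?_ ?_
  · rw [FiberBundle.extChartAt]
    rfl
  · rw [extChartAt_tangent_snd, extChartAt_tangent_snd, ← map_smul]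
    rfl
  
lemma isOpen_slit : IsOpen (slit n M) := by
  refine isOpen_iff_mem_nhds.2 fun p hp => ?_
  have h1 : (extChartAt (𝓡 n).tangent p p).2 ≠ 0 := by
    have : extChartAt (𝓡 n).tangent p p = (extChartAt (𝓡 n) p.1 p.1, fib p) :=
      extChartAt_tvec p.1 (fib p) (fib p)
    rw [this]
    exact hp
  have h2 : ContinuousAt (fun q => (extChartAt (𝓡 n).tangent p q).2) p :=
    (continuousAt_extChartAt p).snd
  filter_upwards [h2.eventually_ne h1] with q hq h0
  refine hq ?_
  rw [extChartAt_tangent_snd, show fib q = 0 from h0, map_zero]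

/-- The derivative of the chart of `TM` maps the Liouville field to the field `(0, u)`. -/
lemma mfderiv_extChartAt_liouville (p q : TM n M)
    (hq : q ∈ (chartAt (ModelProd (Euc n) (Euc n)) p).source) :
    mfderiv (𝓡 n).tangent 𝓘(ℝ, Euc n × Euc n) (extChartAt (𝓡 n).tangent p) q (liouville q) =
      ((0, (extChartAt (𝓡 n).tangent p q).2) : Euc n × Euc n) := by
  rw [liouville_eq]
  -- Tangent spaces depend on the base point, so `q = scale 1 q` is used by substituting for a free
  -- `q'`. The claim is then the chain rule along the ray, which the chart maps to a straight line.
  have key : ∀ q', q' = scale 1 q → 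
      mfderiv (𝓡 n).tangent 𝓘(ℝ, Euc n × Euc n) (extChartAt (𝓡 n).tangent p) q'
        ((0, fib q) : Euc n × Euc n) =
      ((0, (extChartAt (𝓡 n).tangent p q).2) : Euc n × Euc n) := by
    rintro q' rfl
    have h1 : MDifferentiableAt (𝓡 n).tangent 𝓘(ℝ, Euc n × Euc n)
        (extChartAt (𝓡 n).tangent p) (scale 1 q) :=
      mdifferentiableAt_extChartAt (by rw [scale_one]; exact hq)
    have h2 := h1.hasMFDerivAt.comp (1 : ℝ) (hasMFDerivAt_scale q 1)
    have h3 : (extChartAt (𝓡 n).tangent p) ∘ (fun s : ℝ => scale s q) = fun s : ℝ =>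
      ((extChartAt (𝓡 n).tangent p q).1, s • (extChartAt (𝓡 n).tangent p q).2) :=
      funext fun s => extChartAt_tangent_scale p q s
    rw [h3] at h2
    obtain ⟨L, hL, hL1⟩ : ∃ L : ℝ →L[ℝ] Euc n × Euc n,
        HasFDerivAt (fun s : ℝ => ((extChartAt (𝓡 n).tangent p q).1,
          s • (extChartAt (𝓡 n).tangent p q).2)) L 1 ∧
        mfderiv (𝓡 n).tangent 𝓘(ℝ, Euc n × Euc n) (extChartAt (𝓡 n).tangent p) (scale 1 q)
          ((1 : ℝ) • ((0, fib q) : Euc n × Euc n)) = L 1 :=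
      ⟨_, hasMFDerivAt_iff_hasFDerivAt.1 h2, rfl⟩
    have h5 := ((hasDerivAt_const (1 : ℝ) (extChartAt (𝓡 n).tangent p q).1).prodMk
      ((hasDerivAt_id (1 : ℝ)).smul_const (extChartAt (𝓡 n).tangent p q).2)).hasFDerivAt
    rw [hL.unique h5, one_smul] at hL1
    exact hL1.trans ((one_smul ℝ (_ : Euc n × Euc n)).trans (by rw [one_smul]))
  exact key q (scale_one q).symm

end TangentCalculus

/-! ### The Lie bracket at the centre of a chart -/

section BracketInChart

variable {E : Type*} [NormedAddCommGroup E] [NormedSpace ℝ E]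
  {H : Type*} [TopologicalSpace H] {I : ModelWithCorners ℝ E H} 
  {N : Type*} [TopologicalSpace N] [ChartedSpace H N] [IsManifold I 2 N]

lemma inverse_mfderiv_extChartAt_self (x : N) (v : E) :
    (mfderiv I 𝓘(ℝ, E) (extChartAt I x) x).inverse v = v := by
  have h := ContinuousLinearMap.inverse_eq (f := mfderiv I 𝓘(ℝ, E) (extChartAt I x) x)
    (g := ContinuousLinearMap.id ℝ E)
    (by
      have := IsManifold.of_le (I := I) (M := N) (m := 1) (n := 2) (by norm_num)
      rw [mfderiv_extChartAt_self]; rfl)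
    (by
      have := IsManifold.of_le (I := I) (M := N) (m := 1) (n := 2) (by norm_num)
      rw [mfderiv_extChartAt_self]; rfl)
  exact congrArg (fun L : E →L[ℝ] E => L v) h

/-- The manifold bracket is the bracket of the coordinate expressions carried back by the inverse
differential of the chart, which is the identity at the chart's own centre. -/
lemma mlieBracket_eq_lieBracket [I.Boundaryless] {V W : ∀ y : N, TangentSpace I y} {x : N} :
    VectorField.mlieBracket I V W x =
      VectorField.lieBracket ℝ
        (VectorField.mpullbackWithin 𝓘(ℝ, E) I (extChartAt I x).symm V (range I))
        (VectorField.mpullbackWithin 𝓘(ℝ, E) I (extChartAt I x).symm W (range I))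
        (extChartAt I x x) := by
  refine (VectorField.mlieBracketWithin_apply (I := I) (V := V) (W := W) (s := univ)).trans ?_
  refine (inverse_mfderiv_extChartAt_self (I := I) x _).trans ?_
  rw [preimage_univ, univ_inter]
  simp only [I.range_eq_univ]
  exact congrFun (VectorField.lieBracketWithin_univ (𝕜 := ℝ) (E := E)) _

end BracketInChart

/-! ### The bracket with the Liouville field -/

section LieBracket

variable {n : ℕ} {M : Type*} [TopologicalSpace M] [ChartedSpace (Euc n) M]
  [IsManifold (𝓡 n) ∞ M]

/-- The expression of a vector field on `TM` in the induced coordinates at `p`. -/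
def coordField (p : TM n M) (W : ∀ q : TM n M, TangentSpace (𝓡 n).tangent q)
    (q : TM n M) : Euc n × Euc n :=
  mfderiv (𝓡 n).tangent 𝓘(ℝ, Euc n × Euc n) (extChartAt (𝓡 n).tangent p) q (W q)

lemma coordField_eq_trivializationAt (p q : TM n M)
    (W : ∀ q : TM n M, TangentSpace (𝓡 n).tangent q)
    (hq : q ∈ (chartAt (ModelProd (Euc n) (Euc n)) p).source) :
    coordField p W q =
      (trivializationAt (Euc n × Euc n) (TangentSpace (𝓡 n).tangent) p ⟨q, W q⟩).2 := by
  have h := TangentBundle.continuousLinearMapAt_trivializationAt (I := (𝓡 n).tangent) hq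
  have h1 := congrArg (fun L => L (W q)) h
  refine Eq.trans h1.symm ?_
  have h2 := (trivializationAt (Euc n × Euc n) (TangentSpace (𝓡 n).tangent) p).coe_linearMapAt_of_mem
    (R := ℝ) (b := q) hq
  exact congrFun h2 (W q)

/-- All points of the ray share one preferred chart, so along it the raw values of `W` already are
its coordinates at `p`. -/
lemma coordField_scale (p : TM n M) (W : ∀ q : TM n M, TangentSpace (𝓡 n).tangent q) (s : ℝ) :
    coordField p W (scale s p) = W (scale s p) := by
  have h := mfderiv_extChartAt_self (I := (𝓡 n).tangent) (x := scale s p)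
  exact congrArg (fun L => L (W (scale s p))) h

lemma contMDiffAt_coordField (p : TM n M) (W : ∀ q : TM n M, TangentSpace (𝓡 n).tangent q)
    {U : Set (TM n M)} (hU : U ∈ 𝓝 p) (hW : IsSmoothField W U) :
    ContMDiffAt (𝓡 n).tangent 𝓘(ℝ, Euc n × Euc n) ∞ (coordField p W) p := by
  have h := (contMDiffAt_totalSpace.1 ((hW p (mem_of_mem_nhds hU)).contMDiffAt hU)).2
  refine h.congr_of_eventuallyEq ?_
  filter_upwards [chart_source_mem_nhds (ModelProd (Euc n) (Euc n)) p] with q hq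
  exact coordField_eq_trivializationAt p q W hq

lemma mpullbackWithin_extChartAt_symm (p : TM n M)
    (W : ∀ q : TM n M, TangentSpace (𝓡 n).tangent q) {z : Euc n × Euc n}
    (hz : z ∈ (extChartAt (𝓡 n).tangent p).target) :
    VectorField.mpullbackWithin 𝓘(ℝ, Euc n × Euc n) (𝓡 n).tangent
      (extChartAt (𝓡 n).tangent p).symm W (range (𝓡 n).tangent) z =
    coordField p W ((extChartAt (𝓡 n).tangent p).symm z) := by
  rw [VectorField.mpullbackWithin_apply, ContinuousLinearMap.inverse_eq
    (mfderivWithin_extChartAt_symm_comp_mfderiv_extChartAt hz)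
    (mfderiv_extChartAt_comp_mfderivWithin_extChartAt_symm hz)]
  rfl

/-- The Lie bracket with the Liouville field, computed in induced coordinates. -/
lemma mlieBracket_liouville (p : TM n M) (W : ∀ q : TM n M, TangentSpace (𝓡 n).tangent q)
    {U : Set (TM n M)} (hU : U ∈ 𝓝 p) (hW : IsSmoothField W U) :
    ∃ D : Euc n × Euc n,
      HasDerivAt (fun s : ℝ => (W (scale s p) : Euc n × Euc n)) D 1 ∧
      VectorField.mlieBracket (𝓡 n).tangent liouville W p =
        D - ((0, (W p : Euc n × Euc n).2) : Euc n × Euc n) := by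
  have htgt := extChartAt_target_mem_nhds (I := (𝓡 n).tangent) p
  have hinv : (extChartAt (𝓡 n).tangent p).symm (extChartAt (𝓡 n).tangent p p) = p :=
    extChartAt_to_inv p
  have hself : extChartAt (𝓡 n).tangent p p = (extChartAt (𝓡 n) p.1 p.1, fib p) :=
    extChartAt_tvec p.1 (fib p) (fib p)
  have hsmooth : ContDiffAt ℝ ∞
      (fun z => coordField p W ((extChartAt (𝓡 n).tangent p).symm z))
      (extChartAt (𝓡 n).tangent p p) := by
    have h1 := contMDiffAt_coordField p W hU hW
    have h2 : ContMDiffAt 𝓘(ℝ, Euc n × Euc n) (𝓡 n).tangent ∞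
        (extChartAt (𝓡 n).tangent p).symm (extChartAt (𝓡 n).tangent p p) :=
      (contMDiffOn_extChartAt_symm p).contMDiffAt htgt
    exact (ContMDiffAt.comp_of_eq h1 h2 hinv).contDiffAt
  have hdiff := hsmooth.differentiableAt (by simp)
  have hcW : coordField p W p = W p := by
    have h := mfderiv_extChartAt_self (I := (𝓡 n).tangent) (x := p)
    exact congrArg (fun L => L (W p)) h
  -- In the chart the Liouville field is the linear field `(x, u) ↦ (0, u)`, so the bracket is
  -- `DW(0, u) - (0, W₂)`. The first term is the derivative of `W` along the ray.
  refine ⟨fderiv ℝ (fun z => coordField p W ((extChartAt (𝓡 n).tangent p).symm z))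
    (extChartAt (𝓡 n).tangent p p) (0, fib p), ?_, ?_⟩
  · have hline : HasDerivAt (fun s : ℝ => (extChartAt (𝓡 n) p.1 p.1, s • fib p))
        ((0, fib p) : Euc n × Euc n) 1 := by
      simpa using (hasDerivAt_const (1 : ℝ) (extChartAt (𝓡 n) p.1 p.1)).prodMk
        ((hasDerivAt_id (1 : ℝ)).smul_const (fib p))
    have h1 : (extChartAt (𝓡 n).tangent p p) =
        (fun s : ℝ => (extChartAt (𝓡 n) p.1 p.1, s • fib p)) 1 := by
      simp only [hself, one_smul]
    have h2 := hdiff.hasFDerivAt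
    have h3 := HasFDerivAt.comp_hasDerivAt (1 : ℝ) (h1 ▸ h2) hline
    rw [← h1] at h3
    refine h3.congr_of_eventuallyEq (Filter.Eventually.of_forall fun s => ?_)
    have h4 : (extChartAt (𝓡 n) p.1 p.1, s • fib p) =
        extChartAt (𝓡 n).tangent p (scale s p) :=
      (extChartAt_tvec p.1 (fib p) (s • fib p)).symm
    have h5 : (extChartAt (𝓡 n).tangent p).symm (extChartAt (𝓡 n) p.1 p.1, s • fib p) =
        scale s p := by
      rw [h4]
      exact extChartAt_to_inv (I := (𝓡 n).tangent) (scale s p)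
    refine (coordField_scale p W s).symm.trans ?_
    exact congrArg (coordField p W) h5.symm
  · have hB := mlieBracket_eq_lieBracket (I := (𝓡 n).tangent) (V := liouville) (W := W) (x := p)
    have e1 : (VectorField.mpullbackWithin 𝓘(ℝ, Euc n × Euc n) (𝓡 n).tangent
        (extChartAt (𝓡 n).tangent p).symm liouville (range (𝓡 n).tangent))
        =ᶠ[𝓝 (extChartAt (𝓡 n).tangent p p)] fun z => ((0, z.2) : Euc n × Euc n) := by
      filter_upwards [htgt] with z hz
      refine (mpullbackWithin_extChartAt_symm p _ hz).trans ?_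
      refine (mfderiv_extChartAt_liouville p _ ?_).trans ?_
      · have := (extChartAt (𝓡 n).tangent p).map_target hz
        rwa [extChartAt_source] at this
      · rw [(extChartAt (𝓡 n).tangent p).right_inv hz]
    have e2 : (VectorField.mpullbackWithin 𝓘(ℝ, Euc n × Euc n) (𝓡 n).tangent
        (extChartAt (𝓡 n).tangent p).symm W (range (𝓡 n).tangent))
        =ᶠ[𝓝 (extChartAt (𝓡 n).tangent p p)]
        fun z => coordField p W ((extChartAt (𝓡 n).tangent p).symm z) := by
      filter_upwards [htgt] with z hz
      exact mpullbackWithin_extChartAt_symm p _ hz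
    refine hB.trans ?_
    refine (Filter.EventuallyEq.lieBracket_vectorField_eq e1 e2).trans ?_
    have h3 : fderiv ℝ (fun z : Euc n × Euc n => ((0, z.2) : Euc n × Euc n))
        (extChartAt (𝓡 n).tangent p p) =
        (0 : Euc n × Euc n →L[ℝ] Euc n).prod (ContinuousLinearMap.snd ℝ (Euc n) (Euc n)) :=
      ((0 : Euc n × Euc n →L[ℝ] Euc n).prod
        (ContinuousLinearMap.snd ℝ (Euc n) (Euc n))).hasFDerivAt.fderiv
    have h4 : coordField p W ((extChartAt (𝓡 n).tangent p).symm (extChartAt (𝓡 n).tangent p p)) =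
        W p := (congrArg (coordField p W) hinv).trans hcW
    have h5 : (extChartAt (𝓡 n).tangent p p).2 = fib p := by rw [hself]
    rw [VectorField.lieBracket, h3, h4, h5]
    rfl

end LieBracket

/-! ### The Lie derivative as the derivative of a pull-back -/

lemma hasDerivAt_bilinear {E : Type*} [NormedAddCommGroup E] [NormedSpace ℝ E]
    {B : ℝ → E →L[ℝ] E →L[ℝ] ℝ} {B' : E →L[ℝ] E →L[ℝ] ℝ} {v w : ℝ → E} {v' w' : E} {t : ℝ}
    (hB : HasDerivAt B B' t) (hv : HasDerivAt v v' t) (hw : HasDerivAt w w' t) :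
    HasDerivAt (fun s => B s (v s) (w s))
      (B' (v t) (w t) + B t v' (w t) + B t (v t) w') t :=
  (hB.clm_apply hv).clm_apply hw

lemma hasDerivAt_of_contDiffAt {E : Type*} [NormedAddCommGroup E] [NormedSpace ℝ E]
    {f : ℝ → E} {t : ℝ} (hf : ContDiffAt ℝ ∞ f t) : HasDerivAt f (deriv f t) t :=
  (hf.differentiableAt (by simp)).hasDerivAt

section LieDerivative

variable {n : ℕ} {M : Type*} [TopologicalSpace M] [ChartedSpace (Euc n) M]
  [IsManifold (𝓡 n) ∞ M]

omit [IsManifold (𝓡 n) ∞ M] in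
lemma scale_mem_slit {p : TM n M} (hp : p ∈ slit n M) {s : ℝ} (hs : s ≠ 0) :
    scale s p ∈ slit n M :=
  smul_ne_zero (M := Euc n) hs hp

/-- The field `G` of bilinear forms along the ray `s ↦ s u`, in induced coordinates. -/
def metricAlong (G : ∀ p : TM n M, TangentSpace (𝓡 n).tangent p →L[ℝ]
    TangentSpace (𝓡 n).tangent p →L[ℝ] ℝ) (p : TM n M) (s : ℝ) :
    (Euc n × Euc n) →L[ℝ] (Euc n × Euc n) →L[ℝ] ℝ :=
  G (scale s p)

lemma trivializationAt_tangent_symm_scale (p : TM n M) (s s' : ℝ) (v : Euc n × Euc n) :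
    (trivializationAt (Euc n × Euc n) (TangentSpace (𝓡 n).tangent) (scale s p)).symm
      (scale s' p) v = v := by
  have hmem : scale s' p ∈ (chartAt (ModelProd (Euc n) (Euc n)) (scale s p)).source :=
    mem_chart_source (ModelProd (Euc n) (Euc n)) (scale s' p)
  have h := TangentBundle.symmL_trivializationAt_eq_core (I := (𝓡 n).tangent) hmem
  refine ((trivializationAt (Euc n × Euc n) (TangentSpace (𝓡 n).tangent)
    (scale s p)).symmL_apply (R := ℝ) hmem v).symm.trans ?_
  refine (congrArg (fun L => L v) h).trans ?_
  exact (tangentBundleCore (𝓡 n).tangent (TM n M)).coordChange_self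
    (achart _ (scale s' p)) (scale s' p) (mem_achart_source _ (scale s' p)) v

/-- Smoothness of `G` is smoothness in a trivialization, and the one at `scale s p` is the identity
on the whole ray. -/
lemma contDiffAt_metricAlong {G : ∀ p : TM n M, TangentSpace (𝓡 n).tangent p →L[ℝ]
    TangentSpace (𝓡 n).tangent p →L[ℝ] ℝ} (hG : IsPseudoRiemannian G) {p : TM n M}
    (hp : p ∈ slit n M) {s : ℝ} (hs : s ≠ 0) : ContDiffAt ℝ ∞ (metricAlong G p) s := by
  have h1 := hG.smooth.contMDiffAt (isOpen_slit.mem_nhds (scale_mem_slit hp hs))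
  have h2 := (h1.comp s (contMDiff_scale p).contMDiffAt)
  have h3 := (contMDiffAt_totalSpace.1 h2).2
  refine ContMDiffAt.contDiffAt (h3.congr_of_eventuallyEq (Filter.Eventually.of_forall fun s' => ?_))
  refine ContinuousLinearMap.ext fun v => ContinuousLinearMap.ext fun w => ?_
  have hmem : scale s' p ∈ (chartAt (ModelProd (Euc n) (Euc n)) (scale s p)).source :=
    mem_chart_source (ModelProd (Euc n) (Euc n)) (scale s' p)
  have h4 := inCoordinates_apply_eq₂ (𝕜 := ℝ) (F₁ := Euc n × Euc n) (F₂ := Euc n × Euc n) (F₃ := ℝ)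
    (E₁ := TangentSpace (𝓡 n).tangent (M := TM n M)) (E₂ := TangentSpace (𝓡 n).tangent (M := TM n M))
    (E₃ := Bundle.Trivial (TM n M) ℝ) (x₀ := scale s p) (x := scale s' p)
    (ϕ := G (scale s' p)) (v := v) (w := w) hmem hmem (mem_univ _)
  refine Eq.trans ?_ h4.symm
  rw [trivializationAt_tangent_symm_scale, trivializationAt_tangent_symm_scale]
  simp
  rfl

/-- Extending `v` with constant components in a trivialization lets the conformal equation be tested
on arbitrary vectors at `p`. -/
lemma exists_smoothField (p : TM n M) (v : Euc n × Euc n) :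
    ∃ Y : ∀ q : TM n M, TangentSpace (𝓡 n).tangent q,
      IsSmoothField Y (chartAt (ModelProd (Euc n) (Euc n)) p).source ∧ Y p = v := by
  set e := trivializationAt (Euc n × Euc n) (TangentSpace (𝓡 n).tangent) p with he
  refine ⟨fun q => e.symm q v, ?_, ?_⟩
  · have h := (e.contMDiffOn_section_iff (IB := (𝓡 n).tangent) (n := ∞)
      (s := fun q => e.symm q v) (a := e.baseSet) (chartAt (ModelProd (Euc n) (Euc n)) p).open_source le_rfl).2
    refine h ((contMDiffOn_const (c := v)).congr fun q hq => ?_)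
    exact congrArg Prod.snd (e.apply_mk_symm hq v)
  · have := trivializationAt_tangent_symm_scale p 1 1 v
    rwa [scale_one] at this

set_option synthInstance.maxHeartbeats 200000 in
set_option maxHeartbeats 1000000 in
/-- The Lie derivative along the Liouville field is the derivative of the pull-back by the
fibrewise scalings. -/
lemma hasDerivAt_lieDerivative {G : ∀ p : TM n M, TangentSpace (𝓡 n).tangent p →L[ℝ]
    TangentSpace (𝓡 n).tangent p →L[ℝ] ℝ} (hG : IsPseudoRiemannian G) {p : TM n M}
    (hp : p ∈ slit n M) {U : Set (TM n M)} (hU : U ∈ 𝓝 p)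
    {Y Z : ∀ q : TM n M, TangentSpace (𝓡 n).tangent q} (hY : IsSmoothField Y U)
    (hZ : IsSmoothField Z U) {v w : Euc n × Euc n} (hv : Y p = v) (hw : Z p = w) :
    HasDerivAt (fun s : ℝ => metricAlong G p s (v.1, s • v.2) (w.1, s • w.2))
      (lieDerivative liouville G Y Z p) 1 := by
  obtain ⟨DY, hDY, hbY⟩ := mlieBracket_liouville p Y hU hY
  obtain ⟨DZ, hDZ, hbZ⟩ := mlieBracket_liouville p Z hU hZ
  have hGd : HasDerivAt (metricAlong G p) (deriv (metricAlong G p) 1) 1 :=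
    hasDerivAt_of_contDiffAt (contDiffAt_metricAlong hG hp one_ne_zero)
  set G' := deriv (metricAlong G p) 1
  have hY1 : (Y (scale 1 p) : Euc n × Euc n) = v := by rw [scale_one]; exact hv
  have hZ1 : (Z (scale 1 p) : Euc n × Euc n) = w := by rw [scale_one]; exact hw
  have hG1 : metricAlong G p 1 = G p := by rw [metricAlong, scale_one]
  -- the derivative of `G(Y, Z)`
  have hD : HasDerivAt (fun s : ℝ => metricAlong G p s (Y (scale s p)) (Z (scale s p)))
      (G' v w + metricAlong G p 1 DY w + metricAlong G p 1 v DZ) 1 := by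
    have h := hasDerivAt_bilinear hGd hDY hDZ
    rw [hY1, hZ1] at h
    exact h
  have hf : MDifferentiableAt (𝓡 n).tangent 𝓘(ℝ, ℝ) (fun q => G q (Y q) (Z q)) p := by
    have h1 := ((hG.smooth.contMDiffAt (isOpen_slit.mem_nhds hp)).mdifferentiableAt
      (by simp)).clm_bundle_apply₂ (F₃ := ℝ) (E₃ := Bundle.Trivial (TM n M) ℝ)
        (((hY p (mem_of_mem_nhds hU)).contMDiffAt hU).mdifferentiableAt (by simp))
        (((hZ p (mem_of_mem_nhds hU)).contMDiffAt hU).mdifferentiableAt (by simp))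
    exact ((mdifferentiableAt_totalSpace _ _).1 h1).2
  have hmf : (mfderiv (𝓡 n).tangent 𝓘(ℝ, ℝ) (fun q => G q (Y q) (Z q)) p (liouville p) : ℝ) =
      G' v w + metricAlong G p 1 DY w + metricAlong G p 1 v DZ := by
    have key : ∀ q', q' = scale 1 p →
        MDifferentiableAt (𝓡 n).tangent 𝓘(ℝ, ℝ) (fun q => G q (Y q) (Z q)) q' →
        (mfderiv (𝓡 n).tangent 𝓘(ℝ, ℝ) (fun q => G q (Y q) (Z q)) q'
          ((0, fib p) : Euc n × Euc n) : ℝ) =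
        G' v w + metricAlong G p 1 DY w + metricAlong G p 1 v DZ := by
      rintro q' rfl hq
      obtain ⟨L, hL, hL1⟩ : ∃ L : ℝ →L[ℝ] ℝ,
          HasFDerivAt (fun s : ℝ => metricAlong G p s (Y (scale s p)) (Z (scale s p))) L 1 ∧
          mfderiv (𝓡 n).tangent 𝓘(ℝ, ℝ) (fun q => G q (Y q) (Z q)) (scale 1 p)
            ((1 : ℝ) • ((0, fib p) : Euc n × Euc n)) = L 1 :=
        ⟨_, hasMFDerivAt_iff_hasFDerivAt.1
          (hq.hasMFDerivAt.comp (1 : ℝ) (hasMFDerivAt_scale p 1)), rfl⟩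
      rw [hL.unique hD.hasFDerivAt, one_smul] at hL1
      exact hL1.trans (one_smul ℝ (_ : ℝ))
    rw [liouville_eq]
    exact key p (scale_one p).symm hf
  -- the derivative of the pull-back
  have hA : ∀ a : Euc n × Euc n, HasDerivAt (fun s : ℝ => ((a.1, s • a.2) : Euc n × Euc n))
      (0, a.2) 1 := fun a => by
    simpa using (hasDerivAt_const (1 : ℝ) a.1).prodMk ((hasDerivAt_id (1 : ℝ)).smul_const a.2)
  have h := hasDerivAt_bilinear hGd (hA v) (hA w)
  simp only [one_smul, Prod.mk.eta] at h
  refine h.congr_deriv ?_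
  -- `DY` and `DZ` cancel between the product rule and the brackets. What survives are the terms
  -- with `(0, v.2)` and `(0, w.2)`, the velocities of the scaled vectors, exactly as in the
  -- derivative of the pull-back.
  have e : lieDerivative liouville G Y Z p =
      (G' v w + metricAlong G p 1 DY w + metricAlong G p 1 v DZ)
      - metricAlong G p 1 (DY - (0, v.2)) w - metricAlong G p 1 v (DZ - (0, w.2)) := by
    rw [← hmf, hG1, lieDerivative, hbY, hbZ, hv, hw]
    rfl
  rw [e]
  simp only [map_sub, sub_apply]
  ring

/-- The Liouville field is conformal exactly if the pull-back of `G` by the fibrewise scalings has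
derivative `2 θ G`. -/
lemma isConformalWith_liouville_iff {G : ∀ p : TM n M, TangentSpace (𝓡 n).tangent p →L[ℝ]
    TangentSpace (𝓡 n).tangent p →L[ℝ] ℝ} (hG : IsPseudoRiemannian G) (θ : TM n M → ℝ) :
    IsConformalWith liouville G θ ↔
      ContMDiffOn (𝓡 n).tangent 𝓘(ℝ, ℝ) ∞ θ (slit n M) ∧
      ∀ p ∈ slit n M, ∀ v w : Euc n × Euc n,
        HasDerivAt (fun s : ℝ => metricAlong G p s (v.1, s • v.2) (w.1, s • w.2))
          (2 * θ p * metricAlong G p 1 v w) 1 := by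
  have hG1 : ∀ p, metricAlong G p 1 = G p := fun p => by rw [metricAlong, scale_one]
  refine and_congr_right fun _ => ⟨fun h p hp v w => ?_, fun h U hU hUs Y Z hY hZ p hp => ?_⟩
  · obtain ⟨Y, hY, hYv⟩ := exists_smoothField p v
    obtain ⟨Z, hZ, hZw⟩ := exists_smoothField p w
    have hUo : IsOpen ((chartAt (ModelProd (Euc n) (Euc n)) p).source ∩ slit n M) :=
      (chartAt (ModelProd (Euc n) (Euc n)) p).open_source.inter isOpen_slit
    have hpU : p ∈ (chartAt (ModelProd (Euc n) (Euc n)) p).source ∩ slit n M :=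
      ⟨mem_chart_source _ p, hp⟩
    have hY' : IsSmoothField Y ((chartAt (ModelProd (Euc n) (Euc n)) p).source ∩ slit n M) :=
      hY.mono inter_subset_left
    have hZ' : IsSmoothField Z ((chartAt (ModelProd (Euc n) (Euc n)) p).source ∩ slit n M) :=
      hZ.mono inter_subset_left
    have h1 := hasDerivAt_lieDerivative hG hp (hUo.mem_nhds hpU) hY' hZ' hYv hZw
    refine h1.congr_deriv ?_
    rw [h _ hUo inter_subset_right Y Z hY' hZ' p hpU, hG1, hYv, hZw]
    rfl
  · have h1 := hasDerivAt_lieDerivative hG (hUs hp) (hU.mem_nhds hp) hY hZ rfl rfl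
    rw [h1.unique (h p (hUs hp) (Y p) (Z p)), hG1]
    rfl

end LieDerivative

/-! ### The fundamental tensor and its homogeneity -/

/-- The chain rule for a dilation needs no differentiability of `f`. This matters because the lemma
is also applied at `u = 0`, where `F ^ 2` need not be smooth. -/
lemma fderiv_smul_of_homogeneous {E E' : Type*} [NormedAddCommGroup E] [NormedSpace ℝ E]
    [NormedAddCommGroup E'] [NormedSpace ℝ E'] {f : E → E'} {s c : ℝ} (hs : s ≠ 0)
    (hf : ∀ u, f (s • u) = c • f u) (u : E) :
    fderiv ℝ f (s • u) = (s⁻¹ * c) • fderiv ℝ f u := by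
  have h := fderiv_comp_smul (𝕜 := ℝ) (f := f) (x := u) s
  rw [show (fun u => f (s • u)) = c • f from funext hf, fderiv_const_smul_field,
    Pi.smul_apply] at h
  rw [mul_smul, h, smul_smul, inv_mul_cancel₀ hs, one_smul]

section FundamentalTensor

variable {n : ℕ} {M : Type*} [TopologicalSpace M] [ChartedSpace (Euc n) M]
  [IsManifold (𝓡 n) ∞ M]

/-- The restriction of `F ^ 2` to the tangent space at `x`. -/
def fibreSq (F : TM n M → ℝ) (x : M) (u : Euc n) : ℝ := F (tvec x u) ^ 2

/-- The fundamental tensor as a bilinear form on `ℝⁿ`. -/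
def gBil (F : TM n M → ℝ) (p : TM n M) : Euc n →L[ℝ] Euc n →L[ℝ] ℝ :=
  (1 / 2 : ℝ) • fderiv ℝ (fderiv ℝ (fibreSq F p.1)) (fib p)

variable {F : TM n M → ℝ}

lemma contDiffAt_fibreSq (hF : IsFinslerNorm F) (x : M) {u : Euc n} (hu : u ≠ 0) :
    ContDiffAt ℝ ∞ (fibreSq F x) u := by
  have h1 : ContMDiffAt (𝓡 n).tangent 𝓘(ℝ, ℝ) ∞ F (tvec x u) :=
    hF.smooth.contMDiffAt (isOpen_slit.mem_nhds hu)
  exact (h1.comp u (contMDiff_tvec x).contMDiffAt).contDiffAt.pow 2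

lemma fundamentalTensor_eq (hF : IsFinslerNorm F) {p : TM n M} (hp : p ∈ slit n M)
    (v w : Euc n) : fundamentalTensor F p v w = gBil F p v w := by
  have hu : fib p ≠ 0 := hp
  have hev : ∀ᶠ t : ℝ in 𝓝 0, fib p + t • v ≠ 0 := by
    have hc : ContinuousAt (fun t : ℝ => fib p + t • v) 0 := by fun_prop
    exact hc.eventually_ne (by simpa using hu)
  have h1 : (fun t : ℝ => deriv (fun s : ℝ => fibreSq F p.1 (fib p + t • v + s • w)) 0)
      =ᶠ[𝓝 0] fun t => fderiv ℝ (fibreSq F p.1) (fib p + t • v) w := by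
    filter_upwards [hev] with t ht
    have hd := ((contDiffAt_fibreSq hF p.1 ht).differentiableAt (by simp)).hasFDerivAt
    have hl : HasDerivAt (fun s : ℝ => fib p + t • v + s • w) w 0 := by
      simpa using ((hasDerivAt_id (0 : ℝ)).smul_const w).const_add (fib p + t • v)
    exact (hd.comp_hasDerivAt_of_eq (0 : ℝ) hl (by simp)).deriv
  have h2 : deriv (fun t : ℝ => fderiv ℝ (fibreSq F p.1) (fib p + t • v) w) 0 =
      fderiv ℝ (fderiv ℝ (fibreSq F p.1)) (fib p) v w := by
    have hd : HasFDerivAt (fderiv ℝ (fibreSq F p.1))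
        (fderiv ℝ (fderiv ℝ (fibreSq F p.1)) (fib p)) (fib p) :=
      (((contDiffAt_fibreSq hF p.1 hu).fderiv_right (m := 1) (by norm_cast)).differentiableAt
        (by simp)).hasFDerivAt
    have hl : HasDerivAt (fun t : ℝ => fib p + t • v) v 0 := by
      simpa using ((hasDerivAt_id (0 : ℝ)).smul_const v).const_add (fib p)
    have h3 := hd.comp_hasDerivAt_of_eq (0 : ℝ) hl (by simp)
    have h4 := h3.clm_apply (hasDerivAt_const (0 : ℝ) w)
    simpa using h4.deriv
  have h5 : fundamentalTensor F p v w = (1 / 2) *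
      deriv (fun t : ℝ => deriv (fun s : ℝ => fibreSq F p.1 (fib p + t • v + s • w)) 0) 0 := rfl
  rw [h5, h1.deriv_eq, h2]
  simp [gBil]

lemma gBil_symm (hF : IsFinslerNorm F) {p : TM n M} (hp : p ∈ slit n M) (v w : Euc n) :
    gBil F p v w = gBil F p w v := by
  have h := (contDiffAt_fibreSq hF p.1 (u := fib p) hp).isSymmSndFDerivAt
    (by simp only [minSmoothness_of_isRCLikeNormedField]; exact WithTop.coe_le_coe.2 le_top)
  simp only [gBil, smul_apply]
  rw [h v w]

lemma gBil_pos (hF : IsFinslerNorm F) {p : TM n M} (hp : p ∈ slit n M) {v : Euc n} (hv : v ≠ 0) :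
    0 < gBil F p v v := by
  rw [← fundamentalTensor_eq hF hp]
  exact hF.posDef p hp v hv

lemma fibreSq_smul (hF : IsFinslerNorm F) (x : M) (u : Euc n) {s : ℝ} (hs : 0 < s) :
    fibreSq F x (s • u) = s ^ 2 * fibreSq F x u := by
  have h : F (tvec x (s • u)) = s * F (tvec x u) := hF.homogeneous (tvec x u) s hs
  rw [fibreSq, h, fibreSq, mul_pow]

/-- Euler's relation, read off directly from `F²((1 + t + s) u) = (1 + t + s)² F²(u)` for small `t`
and `s`. -/
lemma gBil_self (hF : IsFinslerNorm F) {p : TM n M} (hp : p ∈ slit n M) :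
    gBil F p (fib p) (fib p) = F p ^ 2 := by
  rw [← fundamentalTensor_eq hF hp]
  have h5 : fundamentalTensor F p (fib p) (fib p) = (1 / 2) * deriv (fun t : ℝ => deriv
      (fun s : ℝ => fibreSq F p.1 (fib p + t • fib p + s • fib p)) 0) 0 := rfl
  have h1 : (fun t : ℝ => deriv (fun s : ℝ =>
      fibreSq F p.1 (fib p + t • fib p + s • fib p)) 0) =ᶠ[𝓝 0]
      fun t => 2 * (1 + t) * F p ^ 2 := by
    filter_upwards [lt_mem_nhds (show (-1 : ℝ) < 0 by norm_num)] with t ht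
    have h2 : (fun s : ℝ => fibreSq F p.1 (fib p + t • fib p + s • fib p)) =ᶠ[𝓝 0]
        fun s => (1 + t + s) ^ 2 * F p ^ 2 := by
      filter_upwards [lt_mem_nhds (show -(1 + t) < 0 by linarith)] with s hs
      have : fib p + t • fib p + s • fib p = (1 + t + s) • fib p := by module
      rw [this, fibreSq_smul hF _ _ (by linarith)]
      rfl
    rw [h2.deriv_eq]
    have h3 : HasDerivAt (fun s : ℝ => (1 + t + s) ^ 2 * F p ^ 2)
        ((2 * (1 + t + 0) ^ 1 * 1) * F p ^ 2) 0 :=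
      (((hasDerivAt_id (0 : ℝ)).const_add (1 + t)).pow 2).mul_const _
    rw [h3.deriv]
    ring
  rw [h5, h1.deriv_eq]
  have h3 : HasDerivAt (fun t : ℝ => 2 * (1 + t) * F p ^ 2) (2 * 1 * F p ^ 2) 0 :=
    (((hasDerivAt_id (0 : ℝ)).const_add 1).const_mul 2).mul_const _
  rw [h3.deriv]
  ring

lemma finsler_pos (hF : IsFinslerNorm F) {p : TM n M} (hp : p ∈ slit n M) : 0 < F p := by
  have h := gBil_pos hF hp (v := fib p) hp
  rw [gBil_self hF hp] at h
  exact lt_of_le_of_ne (hF.nonneg p) fun h0 => by simp [← h0] at h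

lemma finsler_scale (hF : IsFinslerNorm F) (p : TM n M) {s : ℝ} (hs : 0 < s) :
    F (scale s p) = s * F p :=
  hF.homogeneous p s hs

lemma gBil_scale (hF : IsFinslerNorm F) (p : TM n M) {s : ℝ} (hs : 0 < s) :
    gBil F (scale s p) = gBil F p := by
  have h1 : ∀ u, fderiv ℝ (fibreSq F p.1) (s • u) = s • fderiv ℝ (fibreSq F p.1) u := fun u => by
    rw [fderiv_smul_of_homogeneous hs.ne' (fun u => fibreSq_smul hF p.1 u hs) u]
    congr 1
    field_simp
  have h2 : fderiv ℝ (fderiv ℝ (fibreSq F p.1)) (s • fib p) =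
      fderiv ℝ (fderiv ℝ (fibreSq F p.1)) (fib p) := by
    rw [fderiv_smul_of_homogeneous hs.ne' h1, inv_mul_cancel₀ hs.ne', one_smul]
  exact congrArg (fun L => (1 / 2 : ℝ) • L) h2

-- A linear functional on a space of dimension at least 2 has a nontrivial kernel.
omit [IsManifold (𝓡 n) ∞ M] in
lemma exists_gBil_orthogonal (hn : 2 ≤ n) (F : TM n M → ℝ) (p : TM n M) :
    ∃ X : Euc n, X ≠ 0 ∧ gBil F p X (fib p) = 0 := by
  let f : Euc n →ₗ[ℝ] ℝ := ((gBil F p).flip (fib p)).toLinearMap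
  have h : LinearMap.ker f ≠ ⊥ := LinearMap.ker_ne_bot_of_finrank_lt (by simp; omega)
  obtain ⟨X, hX, hX0⟩ := (Submodule.ne_bot_iff _).1 h
  exact ⟨X, hX0, hX⟩

end FundamentalTensor

/-! ### Degrees of homogeneity, up to the Chern symbols -/

section Homogeneity

variable {n : ℕ}

/-- `f` is positively homogeneous of degree `k` in the fibre variable on `V`. -/
def HomogOn (V : Set (Euc n × Euc n)) (k : ℤ) (f : Euc n × Euc n → ℝ) : Prop :=
  ∀ z ∈ V, ∀ s : ℝ, 0 < s → f (z.1, s • z.2) = s ^ k * f z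

variable {V : Set (Euc n × Euc n)} {k l : ℤ} {f g : Euc n × Euc n → ℝ}

lemma HomogOn.mul (hf : HomogOn V k f) (hg : HomogOn V l g) :
    HomogOn V (k + l) fun z => f z * g z := fun z hz s hs => by
  beta_reduce
  rw [hf z hz s hs, hg z hz s hs, zpow_add₀ hs.ne']
  ring

lemma HomogOn.add (hf : HomogOn V k f) (hg : HomogOn V k g) :
    HomogOn V k fun z => f z + g z := fun z hz s hs => by
  beta_reduce
  rw [hf z hz s hs, hg z hz s hs, mul_add]

lemma HomogOn.sub (hf : HomogOn V k f) (hg : HomogOn V k g) :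
    HomogOn V k fun z => f z - g z := fun z hz s hs => by
  beta_reduce
  rw [hf z hz s hs, hg z hz s hs, mul_sub]

lemma HomogOn.const_mul (hf : HomogOn V k f) (c : ℝ) :
    HomogOn V k fun z => c * f z := fun z hz s hs => by
  beta_reduce
  rw [hf z hz s hs, mul_left_comm]

lemma HomogOn.sum {ι : Type*} {t : Finset ι} {f : ι → Euc n × Euc n → ℝ}
    (hf : ∀ i, HomogOn V k (f i)) : HomogOn V k fun z => ∑ i ∈ t, f i z := fun z hz s hs => by
  rw [Finset.mul_sum]
  exact Finset.sum_congr rfl fun i _ => hf i z hz s hs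

lemma HomogOn.coord (i : Fin n) : HomogOn V 1 fun z => z.2 i := fun z _ s _ => by
  simp

lemma HomogOn.congr_degree (hf : HomogOn V k f) (h : k = l) : HomogOn V l f := h ▸ hf

/-- The fibrewise scaling of `ℝⁿ × ℝⁿ`. -/
def scaleEquiv (s : ℝ) (hs : s ≠ 0) : (Euc n × Euc n) ≃L[ℝ] (Euc n × Euc n) :=
  (ContinuousLinearEquiv.refl ℝ (Euc n)).prodCongr
    (ContinuousLinearEquiv.smulLeft (Units.mk0 s hs))

/-- The chain rule for the linear isomorphism `(x, u) ↦ (x, s u)`. It makes `x`-derivatives keep the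
degree and `u`-derivatives lower it by one. -/
lemma HomogOn.fderiv_apply (hV : IsOpen V) (hf : HomogOn V k f) {z : Euc n × Euc n} (hz : z ∈ V)
    {s : ℝ} (hs : 0 < s) (v : Euc n × Euc n) :
    fderiv ℝ f (z.1, s • z.2) (v.1, s • v.2) = s ^ k * fderiv ℝ f z v := by
  have h1 := (scaleEquiv (n := n) s hs.ne').comp_right_fderiv (f := f) (x := z)
  have h2 : f ∘ scaleEquiv s hs.ne' =ᶠ[𝓝 z] s ^ k • f := by
    filter_upwards [hV.mem_nhds hz] with y hy
    exact hf y hy s hs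
  rw [h2.fderiv_eq, fderiv_const_smul_field, Pi.smul_apply] at h1
  exact (congrArg (fun L => L v) h1).symm

lemma HomogOn.dx (hV : IsOpen V) (hf : HomogOn V k f) (i : Fin n) :
    HomogOn V k (dx i f) := fun z hz s hs => by
  have h := hf.fderiv_apply hV hz hs (EuclideanSpace.single i 1, 0)
  simp only [smul_zero] at h
  exact h

lemma HomogOn.du (hV : IsOpen V) (hf : HomogOn V k f) (i : Fin n) :
    HomogOn V (k - 1) (du i f) := fun z hz s hs => by
  have h := hf.fderiv_apply hV hz hs (0, s⁻¹ • EuclideanSpace.single i 1)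
  simp only [smul_smul, mul_inv_cancel₀ hs.ne', one_smul] at h
  have h2 : ((0, s⁻¹ • EuclideanSpace.single i 1) : Euc n × Euc n) =
      s⁻¹ • ((0, EuclideanSpace.single i 1) : Euc n × Euc n) := by simp
  rw [h2, map_smul, smul_eq_mul] at h
  rw [FinslerLiouville.du, h, zpow_sub_one₀ hs.ne', FinslerLiouville.du]
  ring

variable {L : Euc n × Euc n → ℝ}

lemma HomogOn.gLow (hV : IsOpen V) (hL : HomogOn V 2 L) (i j : Fin n) :
    HomogOn V 0 (gLow L i j) :=
  (((hL.du hV j).du hV i).const_mul (1 / 2)).congr_degree (by norm_num)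

lemma HomogOn.gUp (hV : IsOpen V) (hL : HomogOn V 2 L) (i j : Fin n) :
    HomogOn V 0 (gUp L i j) := fun z hz s hs => by
  have h : (Matrix.of fun k l => FinslerLiouville.gLow L k l (z.1, s • z.2)) =
      Matrix.of fun k l => FinslerLiouville.gLow L k l z := by
    ext a b
    simpa using hL.gLow hV a b z hz s hs
  rw [FinslerLiouville.gUp, h, zpow_zero, one_mul, FinslerLiouville.gUp]

lemma HomogOn.cartanUp (hV : IsOpen V) (hL : HomogOn V 2 L) (i j k : Fin n) :
    HomogOn V (-1) (cartanUp L i j k) :=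
  HomogOn.sum fun l => ((hL.gUp hV i l).mul
    (((((hL.du hV k).du hV j).du hV l)).const_mul (1 / 4))).congr_degree (by norm_num)

lemma HomogOn.formalChristoffel (hV : IsOpen V) (hL : HomogOn V 2 L) (i j k : Fin n) :
    HomogOn V 0 (formalChristoffel L i j k) :=
  HomogOn.const_mul (HomogOn.sum fun l => ((hL.gUp hV i l).mul
    ((((hL.gLow hV l j).dx hV k).add ((hL.gLow hV l k).dx hV j)).sub
      ((hL.gLow hV j k).dx hV l))).congr_degree (by norm_num)) (1 / 2)

lemma HomogOn.nonlinearCoeff (hV : IsOpen V) (hL : HomogOn V 2 L) (i j : Fin n) :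
    HomogOn V 1 (nonlinearCoeff L i j) :=
  HomogOn.sub
    (HomogOn.sum fun k => ((hL.formalChristoffel hV i j k).mul (HomogOn.coord k)).congr_degree
      (by norm_num))
    (HomogOn.sum fun k => HomogOn.sum fun r => HomogOn.sum fun s =>
      ((((hL.cartanUp hV i j k).mul (hL.formalChristoffel hV k r s)).mul (HomogOn.coord r)).mul
        (HomogOn.coord s)).congr_degree (by norm_num))

lemma HomogOn.deltax (hV : IsOpen V) (hL : HomogOn V 2 L) (hf : HomogOn V 0 f) (i : Fin n) :
    HomogOn V 0 (deltax L i f) :=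
  (hf.dx hV i).sub (HomogOn.sum fun j =>
    ((hL.nonlinearCoeff hV j i).mul (hf.du hV j)).congr_degree (by norm_num))

lemma HomogOn.chernChristoffel (hV : IsOpen V) (hL : HomogOn V 2 L) (i j k : Fin n) :
    HomogOn V 0 (chernChristoffel L i j k) :=
  HomogOn.const_mul (HomogOn.sum fun l => ((hL.gUp hV i l).mul
    (((hL.deltax hV (hL.gLow hV l j) k).add (hL.deltax hV (hL.gLow hV l k) j)).sub
      (hL.deltax hV (hL.gLow hV j k) l))).congr_degree (by norm_num)) (1 / 2)

end Homogeneity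

/-! ### Scaling invariance of the horizontal lift -/

section HorizontalLift

variable {n : ℕ} {M : Type*} [TopologicalSpace M] [ChartedSpace (Euc n) M]
  [IsManifold (𝓡 n) ∞ M] {F : TM n M → ℝ}

lemma homogOn_localSq (hF : IsFinslerNorm F) (p : TM n M) :
    HomogOn (extChartAt (𝓡 n).tangent p).target 2 (localSq F p) := fun z hz s hs => by
  set q := (extChartAt (𝓡 n).tangent p).symm z with hq
  have hqs : q ∈ (extChartAt (𝓡 n).tangent p).source :=
    (extChartAt (𝓡 n).tangent p).map_target hz
  have h1 : scale s q ∈ (extChartAt (𝓡 n).tangent p).source := by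
    rw [extChartAt_source] at hqs ⊢
    exact hqs
  have h2 : (extChartAt (𝓡 n).tangent p).symm (z.1, s • z.2) = scale s q := by
    have h3 := extChartAt_tangent_scale p q s
    rw [hq, (extChartAt (𝓡 n).tangent p).right_inv hz, ← hq] at h3
    rw [← h3, (extChartAt (𝓡 n).tangent p).left_inv h1]
  rw [localSq, h2, finsler_scale hF q hs, localSq, ← hq]
  norm_cast
  ring

/-- The horizontal lift with values in `ℝⁿ × ℝⁿ`. -/
def hLift (F : TM n M → ℝ) (p : TM n M) (X : Euc n) : Euc n × Euc n := horizontalLift F p X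

lemma hLift_scale (hF : IsFinslerNorm F) (p : TM n M) (X : Euc n) {s : ℝ} (hs : 0 < s) :
    hLift F (scale s p) X = ((hLift F p X).1, s • (hLift F p X).2) := by
  refine Prod.ext rfl ?_
  ext i
  have hz : extChartAt (𝓡 n).tangent p p = (extChartAt (𝓡 n) p.1 p.1, fib p) :=
    extChartAt_tvec p.1 (fib p) (fib p)
  have hzs : extChartAt (𝓡 n).tangent (scale s p) (scale s p) =
      (extChartAt (𝓡 n) p.1 p.1, s • fib p) := extChartAt_tvec p.1 (s • fib p) (s • fib p)
  -- `localSq` sees the point only through its preferred chart, hence only through the base point.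
  have hL : localSq F (scale s p) = localSq F p := rfl
  have hC : ∀ j k, chernChristoffel (localSq F p) i j k (extChartAt (𝓡 n) p.1 p.1, s • fib p) =
      chernChristoffel (localSq F p) i j k (extChartAt (𝓡 n) p.1 p.1, fib p) := fun j k => by
    have h := (homogOn_localSq hF p).chernChristoffel (isOpen_extChartAt_target p) i j k
      (extChartAt (𝓡 n).tangent p p) (mem_extChartAt_target p) s hs
    rw [hz, zpow_zero, one_mul] at h
    exact h
  have e1 : (hLift F (scale s p) X).2 i = -∑ j, ∑ k, chernChristoffel (localSq F (scale s p)) i j k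
    (extChartAt (𝓡 n).tangent (scale s p) (scale s p)) * X j *
      (extChartAt (𝓡 n).tangent (scale s p) (scale s p)).2 k := rfl
  have e2 : (hLift F p X).2 i = -∑ j, ∑ k, chernChristoffel (localSq F p) i j k
    (extChartAt (𝓡 n).tangent p p) * X j * (extChartAt (𝓡 n).tangent p p).2 k := rfl
  rw [e1, hL, hzs]
  change _ = s * (hLift F p X).2 i
  rw [e2, hz, mul_neg, Finset.mul_sum]
  simp only [hC, Finset.mul_sum, PiLp.smul_apply, smul_eq_mul]
  congr 1
  refine Finset.sum_congr rfl fun j _ => Finset.sum_congr rfl fun k _ => ?_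
  ring

end HorizontalLift

/-! ### The pull-back of an `F`-natural metric, and its nondegeneracy -/

section NaturalMetric

variable {n : ℕ} {M : Type*} [TopologicalSpace M] [ChartedSpace (Euc n) M]
  [IsManifold (𝓡 n) ∞ M] {F : TM n M → ℝ} {α₁ α₂ α₃ β₁ β₂ β₃ : ℝ → ℝ}
  {G : ∀ p : TM n M, TangentSpace (𝓡 n).tangent p →L[ℝ] TangentSpace (𝓡 n).tangent p →L[ℝ] ℝ}

/-- The vertical part of a tangent vector of `TM` at `p`. -/
def vertPart (F : TM n M → ℝ) (p : TM n M) (v : Euc n × Euc n) : Euc n :=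
  v.2 - (hLift F p v.1).2

lemma metricAlong_symm (hG : IsPseudoRiemannian G) {p : TM n M} (hp : p ∈ slit n M) {s : ℝ}
    (hs : 0 < s) (v w : Euc n × Euc n) : metricAlong G p s v w = metricAlong G p s w v :=
  hG.symm _ (scale_mem_slit hp hs.ne') v w

lemma fundamentalTensor_scale (hF : IsFinslerNorm F) {p : TM n M} (hp : p ∈ slit n M) {s : ℝ}
    (hs : 0 < s) (X Y : Euc n) : fundamentalTensor F (scale s p) X Y = gBil F p X Y := by
  rw [fundamentalTensor_eq hF (scale_mem_slit hp hs.ne'), gBil_scale hF p hs]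

lemma fundamentalTensor_scale_self (hF : IsFinslerNorm F) {p : TM n M} (hp : p ∈ slit n M)
    {s : ℝ} (hs : 0 < s) (X : Euc n) :
    fundamentalTensor F (scale s p) X (scale s p).2 = s * gBil F p X (fib p) :=
  (fundamentalTensor_scale hF hp hs X (s • fib p)).trans (by rw [map_smul, smul_eq_mul])

lemma hLift_zero (F : TM n M → ℝ) (p : TM n M) : hLift F p 0 = 0 := by
  refine Prod.ext rfl ?_
  ext i
  have e : (hLift F p 0).2 i = -∑ j, ∑ k, chernChristoffel (localSq F p) i j k
    (extChartAt (𝓡 n).tangent p p) * (0 : Euc n) j * (extChartAt (𝓡 n).tangent p p).2 k := rfl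
  rw [e]
  simp

/-- The factor `s ^ 2` on the second term comes from `g_{su}(X, su) = s g_u(X, u)`, used for both
`X` and `Y`. -/
lemma metricAlong_hh (hF : IsFinslerNorm F) (hnat : IsFNatural F α₁ α₂ α₃ β₁ β₂ β₃ G)
    {p : TM n M} (hp : p ∈ slit n M) {s : ℝ} (hs : 0 < s) (X Y : Euc n) :
    metricAlong G p s (hLift F (scale s p) X) (hLift F (scale s p) Y) =
      (α₁ (s ^ 2 * F p ^ 2) + α₃ (s ^ 2 * F p ^ 2)) * gBil F p X Y
      + s ^ 2 * (β₁ (s ^ 2 * F p ^ 2) + β₃ (s ^ 2 * F p ^ 2)) *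
        (gBil F p X (fib p) * gBil F p Y (fib p)) := by
  have hps := scale_mem_slit hp hs.ne'
  have h : metricAlong G p s (hLift F (scale s p) X) (hLift F (scale s p) Y) = _ :=
    hnat.hh _ hps X Y
  rw [h, fundamentalTensor_scale hF hp hs, fundamentalTensor_scale_self hF hp hs X,
    fundamentalTensor_scale_self hF hp hs Y, finsler_scale hF p hs, mul_pow]
  ring

lemma metricAlong_hv (hF : IsFinslerNorm F) (hnat : IsFNatural F α₁ α₂ α₃ β₁ β₂ β₃ G)
    {p : TM n M} (hp : p ∈ slit n M) {s : ℝ} (hs : 0 < s) (X Y : Euc n) :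
    metricAlong G p s (hLift F (scale s p) X) (0, Y) =
      α₂ (s ^ 2 * F p ^ 2) * gBil F p X Y
      + s ^ 2 * β₂ (s ^ 2 * F p ^ 2) * (gBil F p X (fib p) * gBil F p Y (fib p)) := by
  have hps := scale_mem_slit hp hs.ne'
  have h : metricAlong G p s (hLift F (scale s p) X) (verticalLift (scale s p) Y) = _ :=
    hnat.hv _ hps X Y
  rw [verticalLift_eq] at h
  rw [h, fundamentalTensor_scale hF hp hs, fundamentalTensor_scale_self hF hp hs X,
    fundamentalTensor_scale_self hF hp hs Y, finsler_scale hF p hs, mul_pow]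
  ring

lemma metricAlong_vv (hF : IsFinslerNorm F) (hnat : IsFNatural F α₁ α₂ α₃ β₁ β₂ β₃ G)
    {p : TM n M} (hp : p ∈ slit n M) {s : ℝ} (hs : 0 < s) (X Y : Euc n) :
    metricAlong G p s (0, X) (0, Y) =
      α₁ (s ^ 2 * F p ^ 2) * gBil F p X Y
      + s ^ 2 * β₁ (s ^ 2 * F p ^ 2) * (gBil F p X (fib p) * gBil F p Y (fib p)) := by
  have hps := scale_mem_slit hp hs.ne'
  have h : metricAlong G p s (verticalLift (scale s p) X) (verticalLift (scale s p) Y) = _ :=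
    hnat.vv _ hps X Y
  rw [verticalLift_eq, verticalLift_eq] at h
  rw [h, fundamentalTensor_scale hF hp hs, fundamentalTensor_scale_self hF hp hs X,
    fundamentalTensor_scale_self hF hp hs Y, finsler_scale hF p hs, mul_pow]
  ring

/-- The pull-back of an `F`-natural metric by the fibrewise scalings. -/
lemma metricAlong_scale (hF : IsFinslerNorm F) (hG : IsPseudoRiemannian G)
    (hnat : IsFNatural F α₁ α₂ α₃ β₁ β₂ β₃ G)
    {p : TM n M} (hp : p ∈ slit n M) {s : ℝ} (hs : 0 < s) (v w : Euc n × Euc n) :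
    metricAlong G p s (v.1, s • v.2) (w.1, s • w.2) =
      (α₁ (s ^ 2 * F p ^ 2) + α₃ (s ^ 2 * F p ^ 2)) * gBil F p v.1 w.1
      + s ^ 2 * (β₁ (s ^ 2 * F p ^ 2) + β₃ (s ^ 2 * F p ^ 2)) *
        (gBil F p v.1 (fib p) * gBil F p w.1 (fib p))
      + s * α₂ (s ^ 2 * F p ^ 2) *
        (gBil F p v.1 (vertPart F p w) + gBil F p w.1 (vertPart F p v))
      + s ^ 3 * β₂ (s ^ 2 * F p ^ 2) *
        (gBil F p v.1 (fib p) * gBil F p (vertPart F p w) (fib p)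
          + gBil F p w.1 (fib p) * gBil F p (vertPart F p v) (fib p))
      + s ^ 2 * α₁ (s ^ 2 * F p ^ 2) * gBil F p (vertPart F p v) (vertPart F p w)
      + s ^ 4 * β₁ (s ^ 2 * F p ^ 2) *
        (gBil F p (vertPart F p v) (fib p) * gBil F p (vertPart F p w) (fib p)) := by
  -- The differential of the scaling sends the horizontal part of `v` to a horizontal vector and
  -- multiplies the vertical part by `s`.
  have hdec : ∀ v : Euc n × Euc n, ((v.1, s • v.2) : Euc n × Euc n) =
      hLift F (scale s p) v.1 + s • ((0, vertPart F p v) : Euc n × Euc n) := fun v => by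
    rw [hLift_scale hF p v.1 hs]
    refine Prod.ext ?_ ?_
    · change v.1 = v.1 + s • 0
      simp
    · change s • v.2 = s • (hLift F p v.1).2 + s • (v.2 - (hLift F p v.1).2)
      module
  rw [hdec v, hdec w]
  simp only [map_add, add_apply, map_smul, smul_apply, smul_eq_mul]
  rw [metricAlong_symm hG hp hs (0, vertPart F p v) (hLift F (scale s p) w.1),
    metricAlong_hh hF hnat hp hs, metricAlong_hv hF hnat hp hs, metricAlong_hv hF hnat hp hs,
    metricAlong_vv hF hnat hp hs]
  ring

/-- `metricAlong_scale` at `s = 1`. -/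
lemma metricAlong_one (hF : IsFinslerNorm F) (hG : IsPseudoRiemannian G)
    (hnat : IsFNatural F α₁ α₂ α₃ β₁ β₂ β₃ G)
    {p : TM n M} (hp : p ∈ slit n M) (v w : Euc n × Euc n) :
    metricAlong G p 1 v w =
      (α₁ (F p ^ 2) + α₃ (F p ^ 2)) * gBil F p v.1 w.1
      + (β₁ (F p ^ 2) + β₃ (F p ^ 2)) *
        (gBil F p v.1 (fib p) * gBil F p w.1 (fib p))
      + α₂ (F p ^ 2) *
        (gBil F p v.1 (vertPart F p w) + gBil F p w.1 (vertPart F p v))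
      + β₂ (F p ^ 2) *
        (gBil F p v.1 (fib p) * gBil F p (vertPart F p w) (fib p)
          + gBil F p w.1 (fib p) * gBil F p (vertPart F p v) (fib p))
      + α₁ (F p ^ 2) * gBil F p (vertPart F p v) (vertPart F p w)
      + β₁ (F p ^ 2) *
        (gBil F p (vertPart F p v) (fib p) * gBil F p (vertPart F p w) (fib p)) := by
  have h := metricAlong_scale hF hG hnat hp one_pos v w
  simpa only [one_pow, one_mul, one_smul] using h

lemma eq_zero_of_metricAlong (hG : IsPseudoRiemannian G) {p : TM n M} (hp : p ∈ slit n M)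
    {v : Euc n × Euc n} (h : ∀ w, metricAlong G p 1 v w = 0) : v = 0 :=
  hG.nondegenerate (scale 1 p) (scale_mem_slit hp one_ne_zero) v h

lemma vertPart_hLift_add (F : TM n M → ℝ) (p : TM n M) (X Y : Euc n) :
    vertPart F p (X, (hLift F p X).2 + Y) = Y := by
  simp [vertPart]

/-- A singular symmetric `2 × 2` matrix has a kernel vector. -/
lemma exists_kernel_of_det_eq_zero {a b c : ℝ} (h : a * c - b ^ 2 = 0) :
    ∃ x y : ℝ, (x ≠ 0 ∨ y ≠ 0) ∧ x * a + y * b = 0 ∧ x * b + y * c = 0 := by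
  by_cases hab : a = 0 ∧ b = 0
  · exact ⟨1, 0, Or.inl one_ne_zero, by simp [hab.1], by simp [hab.2]⟩
  · refine ⟨b, -a, ?_, by ring, by linarith⟩
    by_contra! h0
    exact hab ⟨by simpa using h0.2, h0.1⟩

lemma hLift_add_eq_zero {F : TM n M → ℝ} {p : TM n M} {X : Euc n} (hX : X ≠ 0) {x y : ℝ}
    (h : ((x • X, (hLift F p (x • X)).2 + y • X) : Euc n × Euc n) = 0) : x = 0 ∧ y = 0 := by
  have hx0 : x = 0 := (smul_eq_zero.1 (congrArg Prod.fst h)).resolve_right hX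
  subst hx0
  have hy : (hLift F p ((0 : ℝ) • X)).2 + y • X = 0 := congrArg Prod.snd h
  rw [zero_smul, hLift_zero, Prod.snd_zero, zero_add] at hy
  exact ⟨rfl, (smul_eq_zero.1 hy).resolve_right hX⟩

/-- For `X` orthogonal to `u` the `β`-terms vanish on `x X^h + y X^v`, and `G` acts through the
matrix of the `α`'s. A kernel vector of that matrix would be a null direction of `G`. -/
lemma det_ne_zero (hF : IsFinslerNorm F) (hG : IsPseudoRiemannian G)
    (hnat : IsFNatural F α₁ α₂ α₃ β₁ β₂ β₃ G) (hn : 2 ≤ n) {p : TM n M} (hp : p ∈ slit n M) :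
    (α₁ (F p ^ 2) + α₃ (F p ^ 2)) * α₁ (F p ^ 2) - α₂ (F p ^ 2) ^ 2 ≠ 0 := fun h => by
  obtain ⟨x, y, hxy, h1, h2⟩ := exists_kernel_of_det_eq_zero h
  obtain ⟨X, hX, hXu⟩ := exists_gBil_orthogonal hn F p
  have h0 : ((x • X, (hLift F p (x • X)).2 + y • X) : Euc n × Euc n) = 0 := by
    refine eq_zero_of_metricAlong hG hp fun w => ?_
    rw [metricAlong_one hF hG hnat hp, vertPart_hLift_add]
    simp only [map_smul, smul_apply, smul_eq_mul, hXu, gBil_symm hF hp w.1 X]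
    linear_combination (gBil F p X w.1) * h1 + (gBil F p X (vertPart F p w)) * h2
  obtain ⟨hx, hy⟩ := hLift_add_eq_zero hX h0
  tauto

/-- The same argument with `X = u`: since `g_u(u, u) = r²`, each `α` is now joined by `r²` times the
corresponding `β`. -/
lemma det_ne_zero' (hF : IsFinslerNorm F) (hG : IsPseudoRiemannian G)
    (hnat : IsFNatural F α₁ α₂ α₃ β₁ β₂ β₃ G) {p : TM n M} (hp : p ∈ slit n M) :
    ((α₁ (F p ^ 2) + α₃ (F p ^ 2)) + F p ^ 2 * (β₁ (F p ^ 2) + β₃ (F p ^ 2)))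
      * (α₁ (F p ^ 2) + F p ^ 2 * β₁ (F p ^ 2))
      - (α₂ (F p ^ 2) + F p ^ 2 * β₂ (F p ^ 2)) ^ 2 ≠ 0 := fun h => by
  obtain ⟨x, y, hxy, h1, h2⟩ := exists_kernel_of_det_eq_zero h
  have h0 : ((x • fib p, (hLift F p (x • fib p)).2 + y • fib p) : Euc n × Euc n) = 0 := by
    refine eq_zero_of_metricAlong hG hp fun w => ?_
    rw [metricAlong_one hF hG hnat hp, vertPart_hLift_add]
    simp only [map_smul, smul_apply, smul_eq_mul, gBil_symm hF hp (fib p) w.1,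
      gBil_symm hF hp (fib p) (vertPart F p w), gBil_self hF hp]
    linear_combination (gBil F p w.1 (fib p)) * h1 + (gBil F p (vertPart F p w) (fib p)) * h2
  obtain ⟨hx, hy⟩ := hLift_add_eq_zero (X := fib p) hp h0
  tauto

end NaturalMetric

/-! ### The differential equations for the coefficients -/

section Calculus

lemma hasDerivAt_sqrt_div {t : ℝ} (ht : 0 < t) :
    HasDerivAt (fun τ : ℝ => √(τ / t)) (1 / (2 * t)) t := by
  have h := ((hasDerivAt_id t).div_const t).sqrt (by simp [ht.ne'])
  refine h.congr_deriv ?_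
  simp only [id, div_self ht.ne', Real.sqrt_one]
  field_simp

lemma sqrt_div_sq_mul {t τ : ℝ} (ht : 0 < t) (hτ : 0 < τ) : √(τ / t) ^ 2 * t = τ := by
  rw [Real.sq_sqrt (div_pos hτ ht).le, div_mul_cancel₀ _ ht.ne']

/-- `s ↦ sᵏ f(s² t)` has logarithmic derivative `2 θ` at `s = 1`. -/
def ScalesAt (θ t : ℝ) (k : ℕ) (f : ℝ → ℝ) : Prop :=
  HasDerivAt (fun s : ℝ => s ^ k * f (s ^ 2 * t)) (2 * θ * f t) 1

/-- Substituting `s = √(τ / t)` recovers `f(τ)` as `s^(-k)` times the given function of `s`, so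
differentiability of `f` is a conclusion and not an assumption. -/
lemma ScalesAt.hasDerivAt {θ t : ℝ} {k : ℕ} {f : ℝ → ℝ} (h : ScalesAt θ t k f) (ht : 0 < t) :
    HasDerivAt f ((θ - k / 2) * f t / t) t := by
  have hσ := hasDerivAt_sqrt_div ht
  have hσ1 : √(t / t) = 1 := by rw [div_self ht.ne', Real.sqrt_one]
  have h1 := HasDerivAt.comp_of_eq t h hσ hσ1.symm
  have h2 := (hσ.pow k).inv (by rw [Pi.pow_apply, hσ1, one_pow]; exact one_ne_zero)
  have h3 := h2.mul h1
  have h4 : f =ᶠ[𝓝 t] (((fun τ : ℝ => √(τ / t)) ^ k)⁻¹ *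
      ((fun s : ℝ => s ^ k * f (s ^ 2 * t)) ∘ fun τ => √(τ / t))) := by
    filter_upwards [lt_mem_nhds ht] with τ hτ
    have : 0 < √(τ / t) := Real.sqrt_pos.2 (div_pos hτ ht)
    simp only [Pi.mul_apply, Pi.inv_apply, Pi.pow_apply, Function.comp,
      sqrt_div_sq_mul ht hτ]
    rw [inv_mul_cancel_left₀ (pow_ne_zero _ this.ne')]
  refine (h3.congr_of_eventuallyEq h4).congr_deriv ?_
  simp only [Pi.pow_apply, Pi.inv_apply, Function.comp, hσ1, one_pow, one_mul, inv_one]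
  field_simp
  ring

lemma ScalesAt.of_eq {θ t c : ℝ} {k : ℕ} {f Φ : ℝ → ℝ} (hΦ : HasDerivAt Φ (2 * θ * Φ 1) 1)
    (hc : c ≠ 0) (h : ∀ s : ℝ, 0 < s → Φ s = c * (s ^ k * f (s ^ 2 * t))) : ScalesAt θ t k f := by
  have h1 : (fun s : ℝ => s ^ k * f (s ^ 2 * t)) =ᶠ[𝓝 1] fun s => c⁻¹ * Φ s := by
    filter_upwards [lt_mem_nhds one_pos] with s hs
    rw [h s hs, inv_mul_cancel_left₀ hc]
  refine ((hΦ.const_mul c⁻¹).congr_of_eventuallyEq h1).congr_deriv ?_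
  rw [h 1 one_pos]
  simp only [one_pow, one_mul]
  field_simp

/-- Used for the `β`'s: evaluation on `u` mixes an `α` with a `β`, and the `α` is already known to
scale correctly. -/
lemma ScalesAt.of_eq_add {θ t c d : ℝ} {k l : ℕ} {f h Φ : ℝ → ℝ}
    (hΦ : HasDerivAt Φ (2 * θ * Φ 1) 1) (hf : ScalesAt θ t k f) (hd : d ≠ 0)
    (e : ∀ s : ℝ, 0 < s → Φ s = c * (s ^ k * f (s ^ 2 * t)) + d * (s ^ l * h (s ^ 2 * t))) :
    ScalesAt θ t l h := by
  refine ScalesAt.of_eq (Φ := fun s => Φ s - c * (s ^ k * f (s ^ 2 * t))) ?_ hd fun s hs => ?_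
  · refine (hΦ.sub (HasDerivAt.const_mul c hf)).congr_deriv ?_
    simp only [one_pow, one_mul]
    ring
  · rw [e s hs]
    ring

lemma contDiffAt_of_scaling {t c : ℝ} {k : ℕ} {f Φ : ℝ → ℝ} (ht : 0 < t)
    (hΦ : ContDiffAt ℝ ∞ Φ 1) (hc : c ≠ 0)
    (h : ∀ s : ℝ, 0 < s → Φ s = c * (s ^ k * f (s ^ 2 * t))) : ContDiffAt ℝ ∞ f t := by
  have hσ1 : √(t / t) = 1 := by rw [div_self ht.ne', Real.sqrt_one]
  have hσ : ContDiffAt ℝ ∞ (fun τ : ℝ => √(τ / t)) t :=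
    (contDiffAt_id.div_const t).sqrt (by simp [ht.ne'])
  have hΦ' : ContDiffAt ℝ ∞ Φ √(t / t) := by rwa [hσ1]
  have h1 : ContDiffAt ℝ ∞ (fun τ : ℝ => (c * √(τ / t) ^ k)⁻¹ * Φ (√(τ / t))) t :=
    ((contDiffAt_const.mul (hσ.pow k)).inv (by simp [hσ1, hc])).mul (ContDiffAt.comp t hΦ' hσ)
  refine h1.congr_of_eventuallyEq ?_
  filter_upwards [lt_mem_nhds ht] with τ hτ
  have hpos : 0 < √(τ / t) := Real.sqrt_pos.2 (div_pos hτ ht)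
  rw [h _ hpos, sqrt_div_sq_mul ht hτ, ← mul_assoc c, inv_mul_cancel_left₀]
  positivity

/-- The logarithmic rates cancel, `(Θ - κ) - (1 - κ) - (Θ - 1) = 0`, so `f / (m lam)` has zero
derivative on a connected set. Nothing is required of `Θ`. -/
lemma eq_const_mul_of_ode {Θ f m lam : ℝ → ℝ} {κ : ℝ}
    (hf : ∀ t, 0 < t → HasDerivAt f ((Θ t - κ) * f t / t) t)
    (hm : ∀ t, 0 < t → HasDerivAt m ((1 - κ) * m t / t) t)
    (hl : ∀ t, 0 < t → HasDerivAt lam ((Θ t - 1) * lam t / t) t)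
    (hm0 : ∀ t, 0 < t → m t ≠ 0) (hl0 : ∀ t, 0 < t → lam t ≠ 0) :
    ∃ c, ∀ t, 0 < t → f t = c * (m t * lam t) := by
  have hd : ∀ t, 0 < t → HasDerivAt (fun τ => f τ / (m τ * lam τ)) 0 t := fun t ht => by
    have hne := mul_ne_zero (hm0 t ht) (hl0 t ht)
    refine ((hf t ht).div ((hm t ht).mul (hl t ht)) hne).congr_deriv ?_
    simp only [Pi.mul_apply]
    rw [div_eq_zero_iff]
    left
    field_simp
    ring
  refine ⟨f 1 / (m 1 * lam 1), fun t ht => ?_⟩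
  have h := isOpen_Ioi.is_const_of_deriv_eq_zero (isPreconnected_Ioi (a := (0 : ℝ)))
    (fun τ hτ => (hd τ hτ).differentiableAt.differentiableWithinAt)
    (fun τ hτ => (hd τ hτ).deriv) (mem_Ioi.2 ht) (mem_Ioi.2 one_pos)
  rw [← h, div_mul_cancel₀]
  exact mul_ne_zero (hm0 t ht) (hl0 t ht)

lemma hasDerivAt_rpow_ode (e : ℝ) {t : ℝ} (ht : 0 < t) :
    HasDerivAt (fun τ : ℝ => τ ^ e) (e * t ^ e / t) t := by
  refine (Real.hasDerivAt_rpow_const (Or.inl ht.ne')).congr_deriv ?_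
  rw [Real.rpow_sub_one ht.ne', mul_div_assoc]

variable {α₁ α₂ α₃ β₁ β₂ β₃ lam : ℝ → ℝ} {a₁ a₂ a₃ b₁ b₂ b₃ : ℝ}

/-- Both determinants of `G` are `t λ(t)²` times the determinants of the constants. -/
lemma regular_of_hasForm (h : HasForm α₁ α₂ α₃ β₁ β₂ β₃ lam a₁ a₂ a₃ b₁ b₂ b₃) {t : ℝ}
    (ht : 0 < t) (h1 : (α₁ t + α₃ t) * α₁ t - α₂ t ^ 2 ≠ 0)
    (h2 : ((α₁ t + α₃ t) + t * (β₁ t + β₃ t)) * (α₁ t + t * β₁ t)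
      - (α₂ t + t * β₂ t) ^ 2 ≠ 0) : Regular a₁ a₂ a₃ b₁ b₂ b₃ := by
  obtain ⟨_, e1, e2, e3, e4, e5, e6⟩ := h t ht
  have hs : √t ≠ 0 := (Real.sqrt_pos.2 ht).ne'
  have hst : √t ^ 2 = t := Real.sq_sqrt ht.le
  have e4' : t * β₁ t = b₁ * lam t := by rw [e4]; field_simp
  have e5' : t * β₂ t = b₂ * √t * lam t := by
    rw [e5]; field_simp; rw [hst, mul_comm]
  refine ⟨fun h0 => h1 ?_, fun h0 => h2 ?_⟩
  · rw [e3, e1, e2]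
    linear_combination (t * lam t ^ 2) * h0 - a₂ ^ 2 * lam t ^ 2 * hst
  · rw [e3, e4', e5', e6, e1, e2]
    linear_combination (t * lam t ^ 2) * h0 - (a₂ + b₂) ^ 2 * lam t ^ 2 * hst

/-- Solving the differential equations that express conformality. -/
lemma exists_hasForm_of_ode {Θ : ℝ → ℝ}
    (h1 : ∀ t, 0 < t → HasDerivAt α₁ ((Θ t - 1) * α₁ t / t) t)
    (h2 : ∀ t, 0 < t → HasDerivAt α₂ ((Θ t - 1 / 2) * α₂ t / t) t)
    (h3 : ∀ t, 0 < t → HasDerivAt (fun t => α₁ t + α₃ t) ((Θ t - 0) * (α₁ t + α₃ t) / t) t)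
    (h4 : ∀ t, 0 < t → HasDerivAt β₁ ((Θ t - 2) * β₁ t / t) t)
    (h5 : ∀ t, 0 < t → HasDerivAt β₂ ((Θ t - 3 / 2) * β₂ t / t) t)
    (h6 : ∀ t, 0 < t → HasDerivAt (fun t => β₁ t + β₃ t) ((Θ t - 1) * (β₁ t + β₃ t) / t) t)
    (hdet : ∀ t, 0 < t → (α₁ t + α₃ t) * α₁ t - α₂ t ^ 2 ≠ 0) :
    ∃ (lam : ℝ → ℝ) (a₁ a₂ a₃ b₁ b₂ b₃ : ℝ), HasForm α₁ α₂ α₃ β₁ β₂ β₃ lam a₁ a₂ a₃ b₁ b₂ b₃ := by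
  set D : ℝ → ℝ := fun t => (α₁ t + α₃ t) * α₁ t - α₂ t ^ 2 with hD
  have hDd : ∀ t, 0 < t → HasDerivAt D ((2 * Θ t - 1) * D t / t) t := fun t ht => by
    refine (((h3 t ht).mul (h1 t ht)).sub ((h2 t ht).pow 2)).congr_deriv ?_
    simp only [hD]
    field_simp
    ring
  -- This is `√|D t / t|` wherever `D t / t ≠ 0`, because `Real.log` is the logarithm of the
  -- absolute value; the sign of `D` plays no role.
  set lam : ℝ → ℝ := fun t => Real.exp (1 / 2 * Real.log (D t / t)) with hlam
  have hl0 : ∀ t, 0 < t → lam t ≠ 0 := fun t _ => Real.exp_ne_zero _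
  have hl : ∀ t, 0 < t → HasDerivAt lam ((Θ t - 1) * lam t / t) t := fun t ht => by
    have hne : D t / t ≠ 0 := div_ne_zero (hdet t ht) ht.ne'
    refine (((((hDd t ht).div (hasDerivAt_id t) ht.ne').log hne).const_mul
      (1 / 2)).exp).congr_deriv ?_
    have hD0 : D t ≠ 0 := hdet t ht
    simp only [hlam, Pi.div_apply, id]
    field_simp
    ring
  have hm : ∀ (κ : ℝ) (t : ℝ), 0 < t →
      HasDerivAt (fun τ : ℝ => τ ^ (1 - κ)) ((1 - κ) * t ^ (1 - κ) / t) t :=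
    fun κ t ht => hasDerivAt_rpow_ode (1 - κ) ht
  have hm0 : ∀ (κ : ℝ) (t : ℝ), 0 < t → t ^ (1 - κ) ≠ 0 := fun κ t ht =>
    (Real.rpow_pos_of_pos ht _).ne'
  obtain ⟨a₁, e1⟩ := eq_const_mul_of_ode h1 (hm 1) hl (hm0 1) hl0
  obtain ⟨a₂, e2⟩ := eq_const_mul_of_ode h2 (hm (1 / 2)) hl (hm0 (1 / 2)) hl0
  obtain ⟨a₃, e3⟩ := eq_const_mul_of_ode h3 (hm 0) hl (hm0 0) hl0
  obtain ⟨b₁, e4⟩ := eq_const_mul_of_ode h4 (hm 2) hl (hm0 2) hl0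
  obtain ⟨b₂, e5⟩ := eq_const_mul_of_ode h5 (hm (3 / 2)) hl (hm0 (3 / 2)) hl0
  obtain ⟨b₃, e6⟩ := eq_const_mul_of_ode h6 (hm 1) hl (hm0 1) hl0
  refine ⟨lam, a₁, a₂, a₃, b₁, b₂, b₃, fun t ht => ⟨hl0 t ht, ?_, ?_, ?_, ?_, ?_, ?_⟩⟩
  · rw [e1 t ht]; norm_num
  · rw [e2 t ht, Real.sqrt_eq_rpow, show (1 : ℝ) - 1 / 2 = 1 / 2 by norm_num]; ring
  · rw [e3 t ht]; norm_num; ring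
  · rw [e4 t ht, show (1 : ℝ) - 2 = -1 by norm_num, Real.rpow_neg_one]; ring
  · rw [e5 t ht, Real.sqrt_eq_rpow, show (1 : ℝ) - 3 / 2 = -(1 / 2) by norm_num,
      Real.rpow_neg ht.le]; ring
  · rw [e6 t ht]; norm_num

end Calculus

/-! ### Conformal, homothetic and Killing cases -/

lemma contDiffAt_bilinear {E : Type*} [NormedAddCommGroup E] [NormedSpace ℝ E]
    {B : ℝ → E →L[ℝ] E →L[ℝ] ℝ} {v w : ℝ → E} {t : ℝ}
    (hB : ContDiffAt ℝ ∞ B t) (hv : ContDiffAt ℝ ∞ v t) (hw : ContDiffAt ℝ ∞ w t) :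
    ContDiffAt ℝ ∞ (fun s => B s (v s) (w s)) t :=
  (hB.clm_apply hv).clm_apply hw

section Liouville

variable {n : ℕ} {M : Type*} [TopologicalSpace M] [ChartedSpace (Euc n) M]
  [IsManifold (𝓡 n) ∞ M] {F : TM n M → ℝ} {α₁ α₂ α₃ β₁ β₂ β₃ : ℝ → ℝ}
  {G : ∀ p : TM n M, TangentSpace (𝓡 n).tangent p →L[ℝ] TangentSpace (𝓡 n).tangent p →L[ℝ] ℝ}

/-- The pull-back of `G` by `u ↦ s u`, evaluated on two tangent vectors at `p`. -/
def scalePull (G : ∀ p : TM n M, TangentSpace (𝓡 n).tangent p →L[ℝ]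
    TangentSpace (𝓡 n).tangent p →L[ℝ] ℝ) (p : TM n M) (v w : Euc n × Euc n) (s : ℝ) : ℝ :=
  metricAlong G p s (v.1, s • v.2) (w.1, s • w.2)

lemma scalePull_one (G : ∀ p : TM n M, TangentSpace (𝓡 n).tangent p →L[ℝ]
    TangentSpace (𝓡 n).tangent p →L[ℝ] ℝ) (p : TM n M) (v w : Euc n × Euc n) :
    scalePull G p v w 1 = metricAlong G p 1 v w := by
  simp only [scalePull, one_smul]

lemma contDiffAt_scalePull (hG : IsPseudoRiemannian G) {p : TM n M} (hp : p ∈ slit n M)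
    (v w : Euc n × Euc n) : ContDiffAt ℝ ∞ (scalePull G p v w) 1 :=
  contDiffAt_bilinear (contDiffAt_metricAlong hG hp one_ne_zero)
    (contDiffAt_const.prodMk (contDiffAt_id.smul contDiffAt_const))
    (contDiffAt_const.prodMk (contDiffAt_id.smul contDiffAt_const))

lemma vertPart_hLift (F : TM n M → ℝ) (p : TM n M) (X : Euc n) :
    vertPart F p (hLift F p X) = 0 := sub_self _

lemma vertPart_vertical (F : TM n M → ℝ) (p : TM n M) (X : Euc n) :
    vertPart F p (0, X) = X := by
  simp [vertPart, hLift_zero]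

lemma scalePull_hh (hF : IsFinslerNorm F) (hG : IsPseudoRiemannian G)
    (hnat : IsFNatural F α₁ α₂ α₃ β₁ β₂ β₃ G) {p : TM n M} (hp : p ∈ slit n M) (X Y : Euc n)
    {s : ℝ} (hs : 0 < s) :
    scalePull G p (hLift F p X) (hLift F p Y) s =
      gBil F p X Y * (s ^ 0 * (α₁ (s ^ 2 * F p ^ 2) + α₃ (s ^ 2 * F p ^ 2))) +
      gBil F p X (fib p) * gBil F p Y (fib p) *
        (s ^ 2 * (β₁ (s ^ 2 * F p ^ 2) + β₃ (s ^ 2 * F p ^ 2))) := by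
  rw [scalePull, metricAlong_scale hF hG hnat hp hs, vertPart_hLift, vertPart_hLift]
  change (_ * gBil F p X Y + _ * (gBil F p X (fib p) * gBil F p Y (fib p)) + _ + _ + _ + _ : ℝ) = _
  simp only [map_zero, zero_apply]
  ring

lemma scalePull_hv (hF : IsFinslerNorm F) (hG : IsPseudoRiemannian G)
    (hnat : IsFNatural F α₁ α₂ α₃ β₁ β₂ β₃ G) {p : TM n M} (hp : p ∈ slit n M) (X Y : Euc n)
    {s : ℝ} (hs : 0 < s) :
    scalePull G p (hLift F p X) (0, Y) s =
      gBil F p X Y * (s ^ 1 * α₂ (s ^ 2 * F p ^ 2)) +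
      gBil F p X (fib p) * gBil F p Y (fib p) * (s ^ 3 * β₂ (s ^ 2 * F p ^ 2)) := by
  rw [scalePull, metricAlong_scale hF hG hnat hp hs, vertPart_hLift, vertPart_vertical]
  have h1 : (hLift F p X).1 = X := rfl
  simp only [h1, map_zero, zero_apply]
  ring

lemma scalePull_vv (hF : IsFinslerNorm F) (hG : IsPseudoRiemannian G)
    (hnat : IsFNatural F α₁ α₂ α₃ β₁ β₂ β₃ G) {p : TM n M} (hp : p ∈ slit n M) (X Y : Euc n)
    {s : ℝ} (hs : 0 < s) :
    scalePull G p (0, X) (0, Y) s =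
      gBil F p X Y * (s ^ 2 * α₁ (s ^ 2 * F p ^ 2)) +
      gBil F p X (fib p) * gBil F p Y (fib p) * (s ^ 4 * β₁ (s ^ 2 * F p ^ 2)) := by
  rw [scalePull, metricAlong_scale hF hG hnat hp hs, vertPart_vertical, vertPart_vertical]
  simp only [map_zero, zero_apply]
  ring

lemma scalesAt_of_hasDerivAt (hF : IsFinslerNorm F) (hG : IsPseudoRiemannian G)
    (hnat : IsFNatural F α₁ α₂ α₃ β₁ β₂ β₃ G) (hn : 2 ≤ n) {p : TM n M} (hp : p ∈ slit n M)
    {θ : ℝ} (h : ∀ v w, HasDerivAt (scalePull G p v w) (2 * θ * scalePull G p v w 1) 1) :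
    ScalesAt θ (F p ^ 2) 2 α₁ ∧ ScalesAt θ (F p ^ 2) 1 α₂ ∧
    ScalesAt θ (F p ^ 2) 0 (fun t => α₁ t + α₃ t) ∧ ScalesAt θ (F p ^ 2) 4 β₁ ∧
    ScalesAt θ (F p ^ 2) 3 β₂ ∧ ScalesAt θ (F p ^ 2) 2 (fun t => β₁ t + β₃ t) := by
  obtain ⟨X, hX, hXu⟩ := exists_gBil_orthogonal hn F p
  have hc := (gBil_pos hF hp hX).ne'
  have hu0 : gBil F p (fib p) (fib p) * gBil F p (fib p) (fib p) ≠ 0 := by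
    have := (gBil_pos hF hp (v := fib p) hp).ne'
    exact mul_ne_zero this this
  have h1 : ScalesAt θ (F p ^ 2) 2 α₁ := .of_eq (h (0, X) (0, X)) hc fun s hs => by
    rw [scalePull_vv hF hG hnat hp X X hs, hXu]; ring
  have h2 : ScalesAt θ (F p ^ 2) 1 α₂ := .of_eq (h (hLift F p X) (0, X)) hc fun s hs => by
    rw [scalePull_hv hF hG hnat hp X X hs, hXu]; ring
  have h3 : ScalesAt θ (F p ^ 2) 0 (fun t => α₁ t + α₃ t) :=
    .of_eq (h (hLift F p X) (hLift F p X)) hc fun s hs => by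
      rw [scalePull_hh hF hG hnat hp X X hs, hXu]; ring
  exact ⟨h1, h2, h3,
    .of_eq_add (h (0, fib p) (0, fib p)) h1 hu0 fun s hs => scalePull_vv hF hG hnat hp _ _ hs,
    .of_eq_add (h (hLift F p (fib p)) (0, fib p)) h2 hu0 fun s hs =>
      scalePull_hv hF hG hnat hp _ _ hs,
    .of_eq_add (h (hLift F p (fib p)) (hLift F p (fib p))) h3 hu0 fun s hs =>
      scalePull_hh hF hG hnat hp _ _ hs⟩

lemma contDiffAt_coefficients (hF : IsFinslerNorm F) (hG : IsPseudoRiemannian G)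
    (hnat : IsFNatural F α₁ α₂ α₃ β₁ β₂ β₃ G) (hn : 2 ≤ n) {p : TM n M} (hp : p ∈ slit n M) :
    ContDiffAt ℝ ∞ α₁ (F p ^ 2) ∧ ContDiffAt ℝ ∞ α₂ (F p ^ 2) := by
  obtain ⟨X, hX, hXu⟩ := exists_gBil_orthogonal hn F p
  have hc := (gBil_pos hF hp hX).ne'
  have ht : 0 < F p ^ 2 := pow_pos (finsler_pos hF hp) 2
  refine ⟨contDiffAt_of_scaling (k := 2) ht (contDiffAt_scalePull hG hp (0, X) (0, X)) hc ?_,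
    contDiffAt_of_scaling (k := 1) ht (contDiffAt_scalePull hG hp (hLift F p X) (0, X)) hc ?_⟩ <;>
  intro s hs
  · rw [scalePull_vv hF hG hnat hp X X hs, hXu]; ring
  · rw [scalePull_hv hF hG hnat hp X X hs, hXu]; ring

lemma hasDerivAt_scalePull_of_hasForm (hF : IsFinslerNorm F) (hG : IsPseudoRiemannian G)
    (hnat : IsFNatural F α₁ α₂ α₃ β₁ β₂ β₃ G) {lam : ℝ → ℝ} {a₁ a₂ a₃ b₁ b₂ b₃ : ℝ}
    (h : HasForm α₁ α₂ α₃ β₁ β₂ β₃ lam a₁ a₂ a₃ b₁ b₂ b₃)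
    {p : TM n M} (hp : p ∈ slit n M) {l : ℝ} (hl : HasDerivAt lam l (F p ^ 2))
    (v w : Euc n × Euc n) :
    HasDerivAt (scalePull G p v w)
      (2 * (1 + F p ^ 2 * l / lam (F p ^ 2)) * scalePull G p v w 1) 1 := by
  set t := F p ^ 2 with htdef
  have ht : 0 < t := pow_pos (finsler_pos hF hp) 2
  obtain ⟨hl0, e1, e2, e3, e4, e5, e6⟩ := h t ht
  -- The powers of `t` in `HasForm` complement the weights `s^k`, so all six terms acquire the same
  -- factor.
  have heq : scalePull G p v w =ᶠ[𝓝 1]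
      fun s => s ^ 2 * lam (s ^ 2 * t) / lam t * scalePull G p v w 1 := by
    filter_upwards [lt_mem_nhds one_pos] with s hs
    obtain ⟨-, f1, f2, f3, f4, f5, f6⟩ := h (s ^ 2 * t) (by positivity)
    have hsq : √(s ^ 2 * t) = s * √t := by
      rw [Real.sqrt_mul (by positivity), Real.sqrt_sq hs.le]
    have hst : √t ≠ 0 := (Real.sqrt_pos.2 ht).ne'
    rw [scalePull_one, scalePull, metricAlong_scale hF hG hnat hp hs,
      metricAlong_one hF hG hnat hp, ← htdef, f3, f6, f1, f2, f4, f5, e3, e6, e1, e2, e4, e5, hsq]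
    field_simp
  refine HasDerivAt.congr_of_eventuallyEq ?_ heq
  have h1 : HasDerivAt (fun s : ℝ => s ^ 2) 2 1 := by
    simpa using hasDerivAt_pow 2 (1 : ℝ)
  have h2 : HasDerivAt (fun s : ℝ => lam (s ^ 2 * t)) (l * (2 * t)) 1 :=
    hl.comp_of_eq (1 : ℝ) (h1.mul_const t) (by simp)
  refine (((h1.mul h2).div_const (lam t)).mul_const (scalePull G p v w 1)).congr_deriv ?_
  simp only [one_pow, one_mul]
  field_simp

lemma exists_mem_slit_sq_eq [Nonempty M] (hn : 2 ≤ n) (hF : IsFinslerNorm F) {t : ℝ}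
    (ht : 0 < t) : ∃ p ∈ slit n M, F p ^ 2 = t := by
  obtain ⟨x⟩ := ‹Nonempty M›
  have hp0 : (tvec x (EuclideanSpace.single (⟨0, by omega⟩ : Fin n) (1 : ℝ)) : TM n M) ∈
      slit n M := by
    change (EuclideanSpace.single (⟨0, by omega⟩ : Fin n) (1 : ℝ) : Euc n) ≠ 0
    simp
  set p₀ : TM n M := tvec x (EuclideanSpace.single (⟨0, by omega⟩ : Fin n) (1 : ℝ))
  have hF0 := finsler_pos hF hp0
  have hs : 0 < √t / F p₀ := div_pos (Real.sqrt_pos.2 ht) hF0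
  refine ⟨scale (√t / F p₀) p₀, scale_mem_slit hp0 hs.ne', ?_⟩
  rw [finsler_scale hF _ hs, div_mul_cancel₀ _ hF0.ne', Real.sq_sqrt ht.le]

lemma isConformalWith_iff_scalePull (hG : IsPseudoRiemannian G) (θ : TM n M → ℝ) :
    IsConformalWith liouville G θ ↔
      ContMDiffOn (𝓡 n).tangent 𝓘(ℝ, ℝ) ∞ θ (slit n M) ∧
      ∀ p ∈ slit n M, ∀ v w : Euc n × Euc n,
        HasDerivAt (scalePull G p v w) (2 * θ p * scalePull G p v w 1) 1 := by
  simp only [isConformalWith_liouville_iff hG, scalePull_one]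
  rfl

/-- Regularity excludes `a₁ = a₂ = 0`, so `lam` can be recovered from `α₁` or from `α₂`, both smooth
because `G` is. -/
lemma contDiffOn_lam [Nonempty M] (hF : IsFinslerNorm F) (hG : IsPseudoRiemannian G)
    (hnat : IsFNatural F α₁ α₂ α₃ β₁ β₂ β₃ G) (hn : 2 ≤ n) {lam : ℝ → ℝ}
    {a₁ a₂ a₃ b₁ b₂ b₃ : ℝ} (h : HasForm α₁ α₂ α₃ β₁ β₂ β₃ lam a₁ a₂ a₃ b₁ b₂ b₃)
    (hreg : Regular a₁ a₂ a₃ b₁ b₂ b₃) : ContDiffOn ℝ ∞ lam (Ioi 0) := fun t ht => by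
  have ht0 : 0 < t := ht
  obtain ⟨p, hp, rfl⟩ := exists_mem_slit_sq_eq (M := M) hn hF ht0
  obtain ⟨s1, s2⟩ := contDiffAt_coefficients hF hG hnat hn hp
  refine ContDiffAt.contDiffWithinAt ?_
  by_cases h1 : a₁ = 0
  · have h2 : a₂ ≠ 0 := fun h2 => hreg.1 (by rw [h1, h2]; ring)
    have hs : √(F p ^ 2) ≠ 0 := (Real.sqrt_pos.2 ht0).ne'
    have := s2.div (contDiffAt_const.mul (contDiffAt_id.sqrt ht0.ne')) (mul_ne_zero h2 hs)
    refine this.congr_of_eventuallyEq ?_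
    filter_upwards [lt_mem_nhds ht0] with τ hτ
    have hs : √τ ≠ 0 := (Real.sqrt_pos.2 hτ).ne'
    simp only [Pi.div_apply, id, (h τ hτ).2.2.1]
    field_simp
  · refine (s1.div_const a₁).congr_of_eventuallyEq ?_
    filter_upwards [lt_mem_nhds ht0] with τ hτ
    rw [(h τ hτ).2.1, mul_div_cancel_left₀ _ h1]

lemma isConformalWith_iff_of_hasForm [Nonempty M] (hF : IsFinslerNorm F)
    (hG : IsPseudoRiemannian G) (hnat : IsFNatural F α₁ α₂ α₃ β₁ β₂ β₃ G) (hn : 2 ≤ n)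
    {lam : ℝ → ℝ} {a₁ a₂ a₃ b₁ b₂ b₃ : ℝ}
    (h : HasForm α₁ α₂ α₃ β₁ β₂ β₃ lam a₁ a₂ a₃ b₁ b₂ b₃)
    (hreg : Regular a₁ a₂ a₃ b₁ b₂ b₃) (θ : TM n M → ℝ) :
    IsConformalWith liouville G θ ↔
      ∀ p ∈ slit n M, θ p = 1 + F p ^ 2 * deriv lam (F p ^ 2) / lam (F p ^ 2) := by
  have hsm := contDiffOn_lam hF hG hnat hn h hreg
  have hpos : ∀ p ∈ slit n M, 0 < F p ^ 2 := fun p hp => pow_pos (finsler_pos hF hp) 2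
  have hd : ∀ p ∈ slit n M, HasDerivAt lam (deriv lam (F p ^ 2)) (F p ^ 2) := fun p hp =>
    hasDerivAt_of_contDiffAt (hsm.contDiffAt (Ioi_mem_nhds (hpos p hp)))
  rw [isConformalWith_iff_scalePull hG]
  refine ⟨fun ⟨_, hθ⟩ p hp => ?_, fun hθ => ⟨?_, fun p hp v w => ?_⟩⟩
  · have hex : ∃ v w, scalePull G p v w 1 ≠ 0 := by
      by_contra! h0
      have h1 : ((0, fib p) : Euc n × Euc n) = 0 := eq_zero_of_metricAlong hG hp fun w => by
        rw [← scalePull_one, h0]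
      exact hp (congrArg Prod.snd h1)
    obtain ⟨v, w, hvw⟩ := hex
    have h1 := (hθ p hp v w).unique
      (hasDerivAt_scalePull_of_hasForm hF hG hnat h hp (hd p hp) v w)
    have h2 := mul_right_cancel₀ hvw h1
    linarith
  · have hF2 : ContMDiffOn (𝓡 n).tangent 𝓘(ℝ, ℝ) ∞ (fun p => F p ^ 2) (slit n M) :=
      (contDiff_id.pow 2).contMDiff.comp_contMDiffOn hF.smooth
    have hφ : ContDiffOn ℝ ∞ (fun t => 1 + t * deriv lam t / lam t) (Ioi 0) :=
      contDiffOn_const.add ((contDiffOn_id.mul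
        (hsm.deriv_of_isOpen isOpen_Ioi (by norm_cast))).div hsm fun t ht => (h t ht).1)
    exact (hφ.contMDiffOn.comp hF2 hpos).congr hθ
  · rw [hθ p hp]
    exact hasDerivAt_scalePull_of_hasForm hF hG hnat h hp (hd p hp) v w

lemma exists_hasForm_of_isConformalWith [Nonempty M] (hF : IsFinslerNorm F)
    (hG : IsPseudoRiemannian G) (hnat : IsFNatural F α₁ α₂ α₃ β₁ β₂ β₃ G) (hn : 2 ≤ n)
    {θ : TM n M → ℝ} (hθ : IsConformalWith liouville G θ) :
    ∃ (lam : ℝ → ℝ) (a₁ a₂ a₃ b₁ b₂ b₃ : ℝ),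
      HasForm α₁ α₂ α₃ β₁ β₂ β₃ lam a₁ a₂ a₃ b₁ b₂ b₃ ∧ Regular a₁ a₂ a₃ b₁ b₂ b₃ := by
  have hc := ((isConformalWith_iff_scalePull hG θ).1 hθ).2
  -- `θ` is not known to depend on `r²` alone, so `Θ t` is its value at one chosen point with `F² =
  -- t`; for `t ≤ 0` the choice is arbitrary.
  have hex : ∀ t : ℝ, ∃ p : TM n M, 0 < t → p ∈ slit n M ∧ F p ^ 2 = t := fun t => by
    by_cases ht : 0 < t
    · obtain ⟨p, hp⟩ := exists_mem_slit_sq_eq (M := M) hn hF ht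
      exact ⟨p, fun _ => hp⟩
    · exact ⟨tvec (Classical.arbitrary M) 0, fun h => absurd h ht⟩
  choose P hP using hex
  have hdet : ∀ t, 0 < t → (α₁ t + α₃ t) * α₁ t - α₂ t ^ 2 ≠ 0 := fun t ht => by
    have := det_ne_zero hF hG hnat hn (hP t ht).1
    rwa [(hP t ht).2] at this
  have hS : ∀ t, 0 < t → ScalesAt (θ (P t)) t 2 α₁ ∧ ScalesAt (θ (P t)) t 1 α₂ ∧
      ScalesAt (θ (P t)) t 0 (fun t => α₁ t + α₃ t) ∧ ScalesAt (θ (P t)) t 4 β₁ ∧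
      ScalesAt (θ (P t)) t 3 β₂ ∧ ScalesAt (θ (P t)) t 2 (fun t => β₁ t + β₃ t) := fun t ht => by
    have := scalesAt_of_hasDerivAt hF hG hnat hn (hP t ht).1 (hc _ (hP t ht).1)
    rwa [(hP t ht).2] at this
  obtain ⟨lam, a₁, a₂, a₃, b₁, b₂, b₃, h⟩ := exists_hasForm_of_ode (Θ := fun t => θ (P t))
    (fun t ht => by simpa using (hS t ht).1.hasDerivAt ht)
    (fun t ht => by simpa using (hS t ht).2.1.hasDerivAt ht)
    (fun t ht => by simpa using (hS t ht).2.2.1.hasDerivAt ht)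
    (fun t ht => ((hS t ht).2.2.2.1.hasDerivAt ht).congr_deriv (by norm_num))
    (fun t ht => by simpa using (hS t ht).2.2.2.2.1.hasDerivAt ht)
    (fun t ht => by simpa using (hS t ht).2.2.2.2.2.hasDerivAt ht) hdet
  refine ⟨lam, a₁, a₂, a₃, b₁, b₂, b₃, h, regular_of_hasForm h one_pos (hdet 1 one_pos) ?_⟩
  have := det_ne_zero' hF hG hnat (hP 1 one_pos).1
  rwa [(hP 1 one_pos).2] at this

lemma isHomotheticWith_iff [Nonempty M] (hF : IsFinslerNorm F) (hG : IsPseudoRiemannian G)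
    (hnat : IsFNatural F α₁ α₂ α₃ β₁ β₂ β₃ G) (hn : 2 ≤ n) (θ₀ : ℝ) :
    IsHomotheticWith liouville G θ₀ ↔
      ∃ a₁ a₂ a₃ b₁ b₂ b₃ : ℝ, Regular a₁ a₂ a₃ b₁ b₂ b₃ ∧
        ∀ t : ℝ, 0 < t →
          α₁ t = a₁ * t ^ (θ₀ - 1) ∧ α₂ t = a₂ * t ^ (θ₀ - 1 / 2) ∧
          α₁ t + α₃ t = a₃ * t ^ θ₀ ∧
          β₁ t = b₁ * t ^ (θ₀ - 2) ∧ β₂ t = b₂ * t ^ (θ₀ - 3 / 2) ∧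
          β₁ t + β₃ t = b₃ * t ^ (θ₀ - 1) := by
  have hpw : ∀ t : ℝ, 0 < t → t ^ (θ₀ - 1 / 2) = √t * t ^ (θ₀ - 1) ∧
      t ^ θ₀ = t * t ^ (θ₀ - 1) ∧ t ^ (θ₀ - 2) = t ^ (θ₀ - 1) / t ∧
      t ^ (θ₀ - 3 / 2) = t ^ (θ₀ - 1) / √t := fun t ht => by
    refine ⟨?_, ?_, ?_, ?_⟩
    · rw [Real.sqrt_eq_rpow, ← Real.rpow_add ht]; congr 1; ring
    · rw [Real.rpow_sub_one ht.ne', mul_div_cancel₀ _ ht.ne']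
    · rw [← Real.rpow_sub_one ht.ne']; congr 1; ring
    · rw [Real.sqrt_eq_rpow, ← Real.rpow_sub ht]; congr 1; ring
  constructor
  · intro hθ
    obtain ⟨lam, a₁, a₂, a₃, b₁, b₂, b₃, h, hreg⟩ :=
      exists_hasForm_of_isConformalWith hF hG hnat hn hθ
    have hθ' := (isConformalWith_iff_of_hasForm hF hG hnat hn h hreg _).1 hθ
    have hsm := contDiffOn_lam hF hG hnat hn h hreg
    have hl : ∀ t, 0 < t → HasDerivAt lam ((θ₀ - 1) * lam t / t) t := fun t ht => by
      obtain ⟨p, hp, hpt⟩ := exists_mem_slit_sq_eq (M := M) hn hF ht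
      refine (hasDerivAt_of_contDiffAt (hsm.contDiffAt (Ioi_mem_nhds ht))).congr_deriv ?_
      have h1 := hθ' p hp
      have hl0 := (h _ ht).1
      rw [hpt] at h1
      rw [h1]
      field_simp
      ring
    -- With `κ = 1` and `m = 1` this compares two solutions of the same equation, `lam` and `t^(θ₀ -
    -- 1)`; the factor `c` is then absorbed into the constants.
    obtain ⟨c, hc⟩ := eq_const_mul_of_ode (Θ := fun _ => θ₀) (κ := 1) (f := lam)
      (m := fun _ => 1) (lam := fun t => t ^ (θ₀ - 1)) hl
      (fun t _ => by simpa using hasDerivAt_const t (1 : ℝ))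
      (fun t ht => hasDerivAt_rpow_ode (θ₀ - 1) ht)
      (fun _ _ => one_ne_zero) (fun t ht => (Real.rpow_pos_of_pos ht _).ne')
    have hc0 : c ≠ 0 := fun h0 => (h 1 one_pos).1 (by rw [hc 1 one_pos, h0, zero_mul])
    refine ⟨c * a₁, c * a₂, c * a₃, c * b₁, c * b₂, c * b₃, ⟨?_, ?_⟩, fun t ht => ?_⟩
    · rw [show c * a₁ * (c * a₃) - (c * a₂) ^ 2 = c ^ 2 * (a₁ * a₃ - a₂ ^ 2) by ring]
      exact mul_ne_zero (pow_ne_zero _ hc0) hreg.1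
    · rw [show (c * a₁ + c * b₁) * (c * a₃ + c * b₃) - (c * a₂ + c * b₂) ^ 2 =
        c ^ 2 * ((a₁ + b₁) * (a₃ + b₃) - (a₂ + b₂) ^ 2) by ring]
      exact mul_ne_zero (pow_ne_zero _ hc0) hreg.2
    · obtain ⟨-, e1, e2, e3, e4, e5, e6⟩ := h t ht
      obtain ⟨p1, p2, p3, p4⟩ := hpw t ht
      rw [p1, p2, p3, p4, e3, e6, e1, e2, e4, e5, hc t ht]
      refine ⟨?_, ?_, ?_, ?_, ?_, ?_⟩ <;> ring
  · rintro ⟨a₁, a₂, a₃, b₁, b₂, b₃, hreg, h⟩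
    have hform : HasForm α₁ α₂ α₃ β₁ β₂ β₃ (fun t => t ^ (θ₀ - 1)) a₁ a₂ a₃ b₁ b₂ b₃ :=
      fun t ht => by
        obtain ⟨e1, e2, e3, e4, e5, e6⟩ := h t ht
        obtain ⟨p1, p2, p3, p4⟩ := hpw t ht
        refine ⟨(Real.rpow_pos_of_pos ht _).ne', e1, ?_, ?_, ?_, ?_, e6⟩
        · rw [e2, p1]; ring
        · rw [e3, p2]; ring
        · rw [e4, p3]
        · rw [e5, p4]
    refine (isConformalWith_iff_of_hasForm hF hG hnat hn hform hreg _).2 fun p hp => ?_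
    have ht : 0 < F p ^ 2 := pow_pos (finsler_pos hF hp) 2
    have hne := (Real.rpow_pos_of_pos ht (θ₀ - 1)).ne'
    rw [(hasDerivAt_rpow_ode (θ₀ - 1) ht).deriv]
    generalize F p ^ 2 = t at ht hne
    field_simp
    ring

end Liouville

end FinslerLiouville

end

theorem mainTheorem5 {n : ℕ} (hn : 2 ≤ n) {M : Type*} [TopologicalSpace M] [T2Space M]
    [SecondCountableTopology M] [ConnectedSpace M] [ChartedSpace (FinslerLiouville.Euc n) M]
    [IsManifold (𝓡 n) ∞ M]
    (F : FinslerLiouville.TM n M → ℝ) (hF : FinslerLiouville.IsFinslerNorm F)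
    (α₁ α₂ α₃ β₁ β₂ β₃ : ℝ → ℝ)
    (G : ∀ p : FinslerLiouville.TM n M, TangentSpace (𝓡 n).tangent p →L[ℝ]
      TangentSpace (𝓡 n).tangent p →L[ℝ] ℝ)
    (hG : FinslerLiouville.IsPseudoRiemannian G)
    (hnat : FinslerLiouville.IsFNatural F α₁ α₂ α₃ β₁ β₂ β₃ G) :
    -- the conformal case
    (FinslerLiouville.IsConformal FinslerLiouville.liouville G ↔
      ∃ (lam : ℝ → ℝ) (a₁ a₂ a₃ b₁ b₂ b₃ : ℝ),
        FinslerLiouville.HasForm α₁ α₂ α₃ β₁ β₂ β₃ lam a₁ a₂ a₃ b₁ b₂ b₃ ∧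
        FinslerLiouville.Regular a₁ a₂ a₃ b₁ b₂ b₃) ∧
    -- the potential function
    (∀ (lam : ℝ → ℝ) (a₁ a₂ a₃ b₁ b₂ b₃ : ℝ),
      FinslerLiouville.HasForm α₁ α₂ α₃ β₁ β₂ β₃ lam a₁ a₂ a₃ b₁ b₂ b₃ →
      FinslerLiouville.Regular a₁ a₂ a₃ b₁ b₂ b₃ →
      ContDiffOn ℝ ∞ lam (Ioi 0) ∧
      ∀ θ : FinslerLiouville.TM n M → ℝ,
        FinslerLiouville.IsConformalWith FinslerLiouville.liouville G θ ↔
          ∀ p ∈ FinslerLiouville.slit n M,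
            θ p = 1 + F p ^ 2 * deriv lam (F p ^ 2) / lam (F p ^ 2)) ∧
    -- the homothetic case
    (∀ θ₀ : ℝ, FinslerLiouville.IsHomotheticWith FinslerLiouville.liouville G θ₀ ↔
      ∃ a₁ a₂ a₃ b₁ b₂ b₃ : ℝ, FinslerLiouville.Regular a₁ a₂ a₃ b₁ b₂ b₃ ∧
        ∀ t : ℝ, 0 < t →
          α₁ t = a₁ * t ^ (θ₀ - 1) ∧ α₂ t = a₂ * t ^ (θ₀ - 1 / 2) ∧
          α₁ t + α₃ t = a₃ * t ^ θ₀ ∧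
          β₁ t = b₁ * t ^ (θ₀ - 2) ∧ β₂ t = b₂ * t ^ (θ₀ - 3 / 2) ∧
          β₁ t + β₃ t = b₃ * t ^ (θ₀ - 1)) ∧
    -- the Killing case
    (FinslerLiouville.IsKilling FinslerLiouville.liouville G ↔
      ∃ a₁ a₂ a₃ b₁ b₂ b₃ : ℝ, FinslerLiouville.Regular a₁ a₂ a₃ b₁ b₂ b₃ ∧
        ∀ t : ℝ, 0 < t →
          α₁ t = a₁ * t ^ (-1 : ℝ) ∧ α₂ t = a₂ * t ^ (-(1 / 2) : ℝ) ∧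
          α₁ t + α₃ t = a₃ ∧
          β₁ t = b₁ * t ^ (-2 : ℝ) ∧ β₂ t = b₂ * t ^ (-(3 / 2) : ℝ) ∧
          β₁ t + β₃ t = b₃ * t ^ (-1 : ℝ)) := by
  refine ⟨⟨fun ⟨θ, hθ⟩ =>
      FinslerLiouville.exists_hasForm_of_isConformalWith hF hG hnat hn hθ,
      fun ⟨lam, a₁, a₂, a₃, b₁, b₂, b₃, h, hreg⟩ =>
        ⟨_, (FinslerLiouville.isConformalWith_iff_of_hasForm hF hG hnat hn h hreg _).2
          fun p _ => rfl⟩⟩,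
    fun lam a₁ a₂ a₃ b₁ b₂ b₃ h hreg =>
      ⟨FinslerLiouville.contDiffOn_lam hF hG hnat hn h hreg,
        FinslerLiouville.isConformalWith_iff_of_hasForm hF hG hnat hn h hreg⟩,
    FinslerLiouville.isHomotheticWith_iff hF hG hnat hn, ?_⟩
  have h0 := FinslerLiouville.isHomotheticWith_iff hF hG hnat hn 0
  simp only [zero_sub, Real.rpow_zero, mul_one] at h0
  exact h0
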